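/- **A quantum while-program whose expectation function is nowhere differentiable.** *Language.* Let $\mathcal H_P=\bigotimes_v\mathcal H_v$ be the joint state space of the finitely many quantum variables, where $\mathcal H_v$ has an orthonormal basis $\{|n\rangle_v\}$ containing $|0\rangle$. Parameterized quantum while-programs $P(\theta)$, $\theta\in\mathbb R^k$, are built from $\mathbf{skip}$; $q:=|0\rangle$; $\bar q:=U[\bar q]$ ($U$ unitary); $\bar q:=e^{-i\theta_j\sigma}[\bar q]$ ($\sigma$ a density operator); sequential composition; measurement-controlled $\mathbf{if}$ with finitely many outcomes; and $\mathbf{while}\ M[\bar q]=1\ \mathbf{do}\ P\ \mathbf{od}$ for a two-outcome measurement $M=\{M_0,M_1\}$. The semantics $[\![P(\theta)]\!]$ acts on partial density operators (positive operators of trace at most one): $[\![\mathbf{skip}]\!](\rho)=\rho$; $[\![q:=|0\rangle]\!](\rho)=\sum_n|0\rangle_q\langle n|\rho|n\rangle_q\langle 0|$; a unitary statement with unitary $V$ (that is, $V=U$ or $V=e^{-i\theta_j\sigma}$) sends $\rho$ to $V\rho V^\dagger$; $[\![P_1;P_2]\!]=[\![P_2]\!]\circ[\![P_1]\!]$; $[\![\mathbf{if}]\!](\rho)=\sum_m[\![P_m]\!](\mathcal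 E_m(\rho))$; and $[\![\mathbf{while}]\!](\rho)=\bigsqcup_n\sum_{k=0}^n\mathcal E_0\big(([\![P]\!]\circ\mathcal E_1)^k(\rho)\big)$, the least upper bound in the Löwner order, where $\mathcal E_m(\rho)=M_m\rho M_m^\dagger$. The expectation function for an initial state $\rho$ and an observable $O$ is $\theta\mapsto\operatorname{tr}(O\,[\![P(\theta)]\!](\rho))$. *The program.* Let $q,r$ be qubits, $t_1,t_2$ variables with state space $\ell^2(\mathbb Z)$, $\theta\in\mathbb R$, and let $P(\theta)$ be $$\begin{aligned}&q:=|0\rangle;\ t_1:=|0\rangle;\\&\mathbf{while}\ M[q]=1\ \mathbf{do}\\&\quad t_1:=R[t_1];\ r:=|0\rangle;\ t_2:=|0\rangle;\\&\quad\mathbf{while}\ M[q]=1\ \mathbf{do}\ r:=e^{-i\theta|+\rangle\langle+|}[r];\ t_2:=R[t_2];\ (t_1,t_2,q):=EX[t_1,t_2,q]\ \mathbf{od};\\&\quad q:=H[q]\\&\mathbf{od}\end{aligned}$$ Here $M_0=|1\rangle\langle1|$, $M_1=|0\rangle\langle0|$ (outcome $1$ continues a loop); $R|j\rangle=|j+1\rangle$;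 $H$ is the Hadamard operator with $H|0\rangle=|+\rangle$, $H|1\rangle=|-\rangle$, where $|\pm\rangle=(|0\rangle\pm|1\rangle)/\sqrt2$; and $EX|j,k,b\rangle=|j,k,1-b\rangle$ if $k=2^j$, $EX|j,k,b\rangle=|j,k,b\rangle$ otherwise. Let the initial state have all four variables in the pure state $|0\rangle$, let $O=2|\psi\rangle\langle\psi|$ on $r$ with $|\psi\rangle=(|0\rangle-i|1\rangle)/\sqrt2$, and let $f(\theta)=\operatorname{tr}(O[\![P(\theta)]\!](\rho))$. *The probabilistic counterpart.* With integer variables $q,t_1,t_2$ and a real variable $r$, let $C(\theta)$ be $$\begin{aligned}&q:=0;\ t_1:=0;\\&\mathbf{while}\ q\neq1\ \mathbf{do}\\&\quad t_1:=t_1+1;\ r:=1;\ t_2:=0;\\&\quad\mathbf{while}\ t_2\ne t_1\ \mathbf{do}\ r:=2r;\ t_2:=t_2+1\ \mathbf{od};\\&\quad r:=\sin(r\theta)+1;\ q:=0\oplus_{1/2}1\\&\mathbf{od}\end{aligned}$$ where $q:=0\oplus_{1/2}1$ assigns $0$ or $1$ to $q$, each with probability $\tfrac12$. *Claim.* 1.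 The state space of $P(\theta)$ is infinite-dimensional, the trace defining $f(\theta)$ converges in the product basis, and for every $\theta\in\mathbb R$ $$f(\theta)=1+\sum_{k=1}^\infty\frac1{2^k}\sin(2^k\theta),$$ with a convergent series. 2. $f$ is continuous on $\mathbb R$ and is not differentiable at any point of $\mathbb R$. 3. For every $\theta$ and every initial state of its variables, the expected value of $r$ after running $C(\theta)$ is $f(\theta)$. 4. Consequently, the statement "for every parameterized quantum while-program, every partial density operator $\rho$ as initial state, and every bounded self-adjoint observable $O$, the partial derivatives of the expectation function exist everywhere" is false when the state space is not required to be finite-dimensional. -/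

import Mathlib

open scoped ENNReal

noncomputable section

/-! ### The Hilbert spaces `ℓ²(X)`, kets, and operators -/

/-- The Hilbert space with orthonormal basis indexed by `X`. The tensor product of `ℓ²(X)` and
`ℓ²(Y)` is `ℓ²(X × Y)`. -/
abbrev L2 (X : Type) : Type := lp (fun _ : X => ℂ) 2

/-- Bounded operators on `ℓ²(X)`. They carry the Löwner order `A ≤ B ↔ B - A` positive. -/
abbrev Op (X : Type) : Type := L2 X →L[ℂ] L2 X

open Classical in
/-- The basis vector `|x⟩`. -/
def ket {X : Type} (x : X) : L2 X := lp.single 2 x (1 : ℂ)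

/-- The rank one operator `|a⟩⟨b|`. -/
def ketBra {X : Type} (a b : L2 X) : Op X := InnerProductSpace.rankOne ℂ a b

/-- The trace, `∑ₓ ⟨x|T|x⟩`. -/
def opTrace {X : Type} (T : Op X) : ℂ := ∑' x, T (ket x) x

/-- Density operators: positive semidefinite of trace one. -/
def IsDensity {X : Type} (T : Op X) : Prop :=
  T.IsPositive ∧ HasSum (fun x => T (ket x) x) 1

/-- Partial density operators: positive semidefinite of (finite) trace at most one. -/
def IsPartialDensity {X : Type} (T : Op X) : Prop :=
  T.IsPositive ∧ ∃ t : ℝ, t ≤ 1 ∧ HasSum (fun x => T (ket x) x) (t : ℂ)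

/-- `ρ ↦ K ρ K†`. -/
def sandwich {X : Type} (K ρ : Op X) : Op X := K * ρ * star K

/-- `T` is the least upper bound of the sequence `s` in the set of partial density operators
with the Löwner order. -/
def IsLoewnerLub {X : Type} (s : ℕ → Op X) (T : Op X) : Prop :=
  IsPartialDensity T ∧ (∀ n, s n ≤ T) ∧
    ∀ T', IsPartialDensity T' → (∀ n, s n ≤ T') → T ≤ T'

open Classical in
/-- The least upper bound of a sequence of partial density operators; it exists for every
increasing sequence (and the value `0` for other sequences plays no role). -/
def loewnerLub {X : Type} (s : ℕ → Op X) : Op X :=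
  if h : ∃ T, IsLoewnerLub s T then h.choose else 0

theorem IsLoewnerLub.eq_loewnerLub {X : Type} {s : ℕ → Op X} {T : Op X}
    (h : IsLoewnerLub s T) : loewnerLub s = T := by
  have hex : ∃ T, IsLoewnerLub s T := ⟨T, h⟩
  have hc := hex.choose_spec
  rw [loewnerLub, dif_pos hex]
  exact le_antisymm (hc.2.2 T h.1 h.2.1) (h.2.2 _ hc.1 hc.2.1)

/-! ### Ampliation `A ↦ A ⊗ I` -/

theorem L2.hasSum_sq {X : Type} (ψ : L2 X) : HasSum (fun x => ‖ψ x‖ ^ 2) (‖ψ‖ ^ 2) := by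
  simpa using lp.hasSum_norm (p := 2) (by simp) ψ

theorem L2.memlp_of_summable {X : Type} {f : X → ℂ} (h : Summable fun x => ‖f x‖ ^ 2) :
    Memℓp f 2 := memℓp_gen (by simpa using h)

theorem L2.norm_le_of_hasSum {X : Type} (ψ : L2 X) {a C : ℝ} (hC : 0 ≤ C)
    (h : HasSum (fun x => ‖ψ x‖ ^ 2) a) (ha : a ≤ C ^ 2) : ‖ψ‖ ≤ C := by
  have := (L2.hasSum_sq ψ).unique h
  exact le_of_sq_le_sq (this.trans_le ha) hC

theorem L2.summable_slice {X Y Z : Type} (e : X ≃ Y × Z) (ψ : L2 X) :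
    Summable fun p : Z × Y => ‖ψ (e.symm (p.2, p.1))‖ ^ 2 :=
  (((Equiv.prodComm Z Y).trans e.symm).summable_iff
    (f := fun x => ‖ψ x‖ ^ 2)).2 (L2.hasSum_sq ψ).summable

/-- The slice `y ↦ ψ(y, z)` of `ψ ∈ ℓ²(Y × Z)`. -/
def L2.slice {X Y Z : Type} (e : X ≃ Y × Z) (ψ : L2 X) (z : Z) : L2 Y :=
  ⟨fun y => ψ (e.symm (y, z)), L2.memlp_of_summable ((L2.summable_slice e ψ).prod_factor z)⟩

theorem L2.hasSum_slice {X Y Z : Type} (e : X ≃ Y × Z) (ψ : L2 X) :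
    HasSum (fun z => ‖L2.slice e ψ z‖ ^ 2) (‖ψ‖ ^ 2) := by
  have h : HasSum (fun p : Z × Y => ‖ψ (e.symm (p.2, p.1))‖ ^ 2) (‖ψ‖ ^ 2) :=
    (((Equiv.prodComm Z Y).trans e.symm).hasSum_iff
      (f := fun x => ‖ψ x‖ ^ 2)).2 (L2.hasSum_sq ψ)
  exact h.prod_fiberwise fun z => L2.hasSum_sq (L2.slice e ψ z)

theorem L2.ampliate_summable {X Y Z : Type} (e : X ≃ Y × Z) (A : Op Y) (ψ : L2 X) :
    Summable (fun x => ‖A (L2.slice e ψ (e x).2) (e x).1‖ ^ 2) ∧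
      ∑' x, ‖A (L2.slice e ψ (e x).2) (e x).1‖ ^ 2 ≤ (‖A‖ * ‖ψ‖) ^ 2 := by
  set F : Z × Y → ℝ := fun p => ‖A (L2.slice e ψ p.1) p.2‖ ^ 2 with hF
  have hle : ∀ z, ‖A (L2.slice e ψ z)‖ ^ 2 ≤ ‖A‖ ^ 2 * ‖L2.slice e ψ z‖ ^ 2 := fun z => by
    rw [← mul_pow]; gcongr; exact A.le_opNorm _
  have hs : HasSum (fun z => ‖A‖ ^ 2 * ‖L2.slice e ψ z‖ ^ 2) (‖A‖ ^ 2 * ‖ψ‖ ^ 2) :=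
    (L2.hasSum_slice e ψ).mul_left _
  have hin : ∀ z, HasSum (fun y => F (z, y)) (‖A (L2.slice e ψ z)‖ ^ 2) := fun z =>
    L2.hasSum_sq (A (L2.slice e ψ z))
  have hsum : Summable F := by
    refine (summable_prod_of_nonneg (fun p => by positivity)).2
      ⟨fun z => (hin z).summable, ?_⟩
    simp_rw [fun z => (hin z).tsum_eq]
    exact Summable.of_nonneg_of_le (fun z => by positivity) hle hs.summable
  have hcomp : (fun x => ‖A (L2.slice e ψ (e x).2) (e x).1‖ ^ 2) =
      F ∘ (e.trans (Equiv.prodComm Y Z)) := rfl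
  rw [hcomp]
  refine ⟨((e.trans (Equiv.prodComm Y Z)).summable_iff).2 hsum, ?_⟩
  have h1 : ∑' x, (F ∘ (e.trans (Equiv.prodComm Y Z))) x = ∑' p, F p :=
    (e.trans (Equiv.prodComm Y Z)).tsum_eq F
  rw [h1, mul_pow, hsum.tsum_prod' fun z => (hin z).summable]
  simp_rw [fun z => (hin z).tsum_eq]
  rw [← hs.tsum_eq]
  exact Summable.tsum_le_tsum hle
    (Summable.of_nonneg_of_le (fun z => by positivity) hle hs.summable) hs.summable

/-- The operator `A ⊗ I` on `ℓ²(X) = ℓ²(Y) ⊗ ℓ²(Z)`: it applies `A` to every slice. -/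
def ampliate {X Y Z : Type} (e : X ≃ Y × Z) (A : Op Y) : Op X :=
  LinearMap.mkContinuous
    { toFun := fun ψ => (⟨fun x => A (L2.slice e ψ (e x).2) (e x).1,
        L2.memlp_of_summable (L2.ampliate_summable e A ψ).1⟩ : L2 X)
      map_add' := fun ψ φ => by
        ext x
        have : L2.slice e (ψ + φ) (e x).2 = L2.slice e ψ (e x).2 + L2.slice e φ (e x).2 := rfl
        simp only [this, map_add]
        rfl
      map_smul' := fun c ψ => by
        ext x
        have : L2.slice e (c • ψ) (e x).2 = c • L2.slice e ψ (e x).2 := rfl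
        simp [this] }
    ‖A‖ fun ψ => by
      refine L2.norm_le_of_hasSum _ (by positivity)
        (L2.ampliate_summable e A ψ).1.hasSum (L2.ampliate_summable e A ψ).2

/-- The unitary `|x⟩ ↦ |e x⟩` permuting the basis. -/
def permUnitary {X : Type} (e : X ≃ X) : unitary (Op X) :=
  Unitary.linearIsometryEquiv.symm
    { toFun := fun ψ => (⟨fun x => ψ (e.symm x), L2.memlp_of_summable
          ((e.symm.summable_iff (f := fun x => ‖ψ x‖ ^ 2)).2 (L2.hasSum_sq ψ).summable)⟩ : L2 X)
      invFun := fun ψ => (⟨fun x => ψ (e x), L2.memlp_of_summable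
          ((e.summable_iff (f := fun x => ‖ψ x‖ ^ 2)).2 (L2.hasSum_sq ψ).summable)⟩ : L2 X)
      map_add' := fun _ _ => rfl
      map_smul' := fun _ _ => rfl
      left_inv := fun ψ => by ext x; simp
      right_inv := fun ψ => by ext x; simp
      norm_map' := fun ψ => by
        have h := (e.symm.hasSum_iff (f := fun x => ‖ψ x‖ ^ 2)).2 (L2.hasSum_sq ψ)
        refine (sq_eq_sq₀ (norm_nonneg _) (norm_nonneg _)).1 ?_
        exact (L2.hasSum_sq _).unique h }

/-! ### Parameterized quantum while-programs

`V` is the finite set of quantum variables; the variable `v` has state space `ℓ²(B v)`, with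
orthonormal basis `|n⟩`, `n ∈ B v`, and distinguished basis state `|0⟩`. -/

/-- Basis labels of the joint state space of all variables. -/
abbrev Config {V : Type} (B : V → Type) : Type := ∀ v, B v

/-- Basis labels of the state space of the quantum register `r`, a finite sequence of distinct
variables. -/
abbrev RegConfig {V : Type} (B : V → Type) {n : ℕ} (r : Fin n ↪ V) : Type := ∀ i, B (r i)

/-- The register consisting of the single variable `q`. -/
abbrev singleReg {V : Type} (q : V) : Fin 1 ↪ V := ⟨fun _ => q, fun _ _ _ => Subsingleton.elim _ _⟩

/-- Splitting a configuration into its restrictions to the register and to the other variables. -/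
def regSplit {V : Type} (B : V → Type) {n : ℕ} (r : Fin n ↪ V) :
    Config B ≃ RegConfig B r × (∀ v : {v // v ∉ Set.range r}, B v) :=
  Equiv.ofBijective (fun x => (fun i => x (r i), fun v => x v)) <| by
    classical
    refine ⟨fun x y h => ?_, fun ⟨y, w⟩ => ?_⟩
    · simp only [Prod.mk.injEq] at h
      funext v
      by_cases hv : v ∈ Set.range r
      · obtain ⟨i, rfl⟩ := hv
        exact congrFun h.1 i
      · exact congrFun h.2 ⟨v, hv⟩
    · refine ⟨fun v => if h : v ∈ Set.range r then h.choose_spec ▸ y h.choose else w ⟨v, h⟩, ?_⟩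
      refine Prod.ext (funext fun i => ?_) (funext fun v => ?_)
      · have h : r i ∈ Set.range r := ⟨i, rfl⟩
        simp only [h, dif_pos]
        have key : ∀ (j : Fin n) (hj : r j = r i), (hj ▸ y j : B (r i)) = y i := by
          intro j hj
          obtain rfl := r.injective hj
          rfl
        exact key _ _
      · simp only [dif_neg v.2]

/-- The operator `A` on the register `r`, as an operator on the joint state space. -/
def onReg {V : Type} {B : V → Type} {n : ℕ} (r : Fin n ↪ V) (A : Op (RegConfig B r)) :
    Op (Config B) := ampliate (regSplit B r) A

/-- `k`-parameterized quantum while-programs. -/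
inductive QProg {V : Type} (B : V → Type) (k : ℕ) : Type
  /-- `skip` -/
  | skip : QProg B k
  /-- `q := |0⟩` -/
  | init (q : V) : QProg B k
  /-- `r := U[r]` -/
  | apply {n : ℕ} (r : Fin n ↪ V) (U : unitary (Op (RegConfig B r))) : QProg B k
  /-- `r := e^{-iθ_jσ}[r]`, with `σ` a density operator -/
  | simulate {n : ℕ} (j : Fin k) (r : Fin n ↪ V) (σ : Op (RegConfig B r)) (hσ : IsDensity σ) :
      QProg B k
  /-- `P₁; P₂` -/
  | seq (P₁ P₂ : QProg B k) : QProg B k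
  /-- `if (□ m · M[r] = m → P_m) fi` -/
  | ifte {n m : ℕ} (r : Fin n ↪ V) (M : Fin m → Op (RegConfig B r))
      (hM : ∑ i, star (M i) * M i = 1) (P : Fin m → QProg B k) : QProg B k
  /-- `while M[r] = 1 do P od` -/
  | loop {n : ℕ} (r : Fin n ↪ V) (M₀ M₁ : Op (RegConfig B r))
      (hM : star M₀ * M₀ + star M₁ * M₁ = 1) (P : QProg B k) : QProg B k

namespace QProg

/-- The variables that occur in a program. -/
def vars {V : Type} {B : V → Type} {k : ℕ} : QProg B k → Set V
  | skip => ∅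
  | init q => {q}
  | apply r _ => Set.range r
  | simulate _ r _ _ => Set.range r
  | seq P₁ P₂ => P₁.vars ∪ P₂.vars
  | ifte r _ _ P => Set.range r ∪ ⋃ i, (P i).vars
  | loop r _ _ _ P => Set.range r ∪ P.vars

/-- The denotational semantics `⟦P(θ)⟧(ρ)`. -/
def sem {V : Type} {B : V → Type} [∀ v, Zero (B v)] {k : ℕ} (θ : Fin k → ℝ) :
    QProg B k → Op (Config B) → Op (Config B)
  | skip, ρ => ρ
  | init q, ρ =>
      ∑' n : RegConfig B (singleReg q), sandwich (onReg (singleReg q) (ketBra (ket 0) (ket n))) ρ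
  | apply r U, ρ => sandwich (onReg r U) ρ
  | simulate j r σ _, ρ =>
      sandwich (onReg r (NormedSpace.exp ((-(Complex.I * (θ j : ℂ))) • σ))) ρ
  | seq P₁ P₂, ρ => P₂.sem θ (P₁.sem θ ρ)
  | ifte r M _ P, ρ => ∑ i, (P i).sem θ (sandwich (onReg r (M i)) ρ)
  | loop r M₀ M₁ _ P, ρ =>
      loewnerLub fun n => ∑ k ∈ Finset.range (n + 1),
        sandwich (onReg r M₀) ((fun τ => P.sem θ (sandwich (onReg r M₁) τ))^[k] ρ)

/-- The expectation function `θ ↦ tr(O ⟦P(θ)⟧(ρ))` of a bounded observable `O`; the trace is real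
when `O` is self-adjoint and `ρ` a partial density operator. -/
def expectation {V : Type} {B : V → Type} [∀ v, Zero (B v)] {k : ℕ} (P : QProg B k)
    (ρ O : Op (Config B)) (θ : Fin k → ℝ) : ℝ :=
  (opTrace (O * P.sem θ ρ)).re

end QProg

/-! ### Qubit operators, on a register with one qubit -/

/-- Basis labels of a one-qubit register. -/
abbrev QubitReg : Type := Fin 1 → Fin 2

/-- The qubit states `|0⟩` and `|1⟩`. -/
def qket (b : Fin 2) : L2 QubitReg := ket fun _ => b

/-- `|+⟩ = (|0⟩ + |1⟩)/√2`. -/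
def qplus : L2 QubitReg := ((√2 : ℝ) : ℂ)⁻¹ • (qket 0 + qket 1)

/-- `|-⟩ = (|0⟩ - |1⟩)/√2`. -/
def qminus : L2 QubitReg := ((√2 : ℝ) : ℂ)⁻¹ • (qket 0 - qket 1)

/-- `|ψ⟩ = (|0⟩ - i|1⟩)/√2`. -/
def qpsi : L2 QubitReg := ((√2 : ℝ) : ℂ)⁻¹ • (qket 0 - Complex.I • qket 1)

open Classical in
theorem ket_apply {X : Type} (x y : X) : ket x y = if y = x then 1 else 0 := by
  rw [ket, lp.single_apply, Pi.single_apply]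

theorem inner_ket {X : Type} (x : X) (ψ : L2 X) : inner ℂ (ket x) ψ = ψ x := by
  classical
  have h := lp.inner_single_left (𝕜 := ℂ) (G := fun _ : X => ℂ) x (1 : ℂ) ψ
  simp only [RCLike.inner_apply, map_one, mul_one] at h
  rw [← h, ket]

theorem L2.add_apply {X : Type} (ψ φ : L2 X) (x : X) : (ψ + φ) x = ψ x + φ x := rfl

theorem L2.sub_apply {X : Type} (ψ φ : L2 X) (x : X) : (ψ - φ) x = ψ x - φ x := rfl

theorem L2.smul_apply {X : Type} (c : ℂ) (ψ : L2 X) (x : X) : (c • ψ) x = c * ψ x := rfl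

theorem inner_qket (a : Fin 2) (ψ : L2 QubitReg) : inner ℂ (qket a) ψ = ψ fun _ => a :=
  inner_ket _ _

theorem qubit_ext {ψ φ : L2 QubitReg} (h0 : ψ (fun _ => 0) = φ fun _ => 0)
    (h1 : ψ (fun _ => 1) = φ fun _ => 1) : ψ = φ := by
  ext x
  have hx : x = fun _ => x 0 := funext fun i => by rw [Subsingleton.elim i 0]
  rw [hx]
  generalize x 0 = b
  fin_cases b
  · exact h0
  · exact h1

theorem inv_sqrt_two_mul_self : (((√2 : ℝ) : ℂ)⁻¹) * (((√2 : ℝ) : ℂ)⁻¹) = 1 / 2 := by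
  rw [← mul_inv, ← Complex.ofReal_mul, Real.mul_self_sqrt (by norm_num)]
  norm_num

theorem star_ketBra {X : Type} (a b : L2 X) : star (ketBra a b) = ketBra b a := by
  simp [ketBra, ContinuousLinearMap.star_eq_adjoint]


theorem qket_zero_one : qket 0 (fun _ => 1) = 0 := by
  rw [qket, ket_apply, if_neg]
  exact fun h => absurd (congrFun h 0) (by decide)

theorem qket_one_zero : qket 1 (fun _ => 0) = 0 := by
  rw [qket, ket_apply, if_neg]
  exact fun h => absurd (congrFun h 0) (by decide)

theorem qket_self (b : Fin 2) : qket b (fun _ => b) = 1 := by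
  rw [qket, ket_apply, if_pos rfl]

/-- The Hadamard operator, `|0⟩ ↦ |+⟩`, `|1⟩ ↦ |-⟩`. -/
def hadamardOp : Op QubitReg := ketBra qplus (qket 0) + ketBra qminus (qket 1)

theorem qubit_completeness :
    star (ketBra (qket 1) (qket 1)) * ketBra (qket 1) (qket 1) +
      star (ketBra (qket 0) (qket 0)) * ketBra (qket 0) (qket 0) = 1 := by
  simp only [star_ketBra]
  ext1 ψ
  refine qubit_ext ?_ ?_ <;>
  simp [-lp.coeFn_add, -lp.coeFn_sub, -lp.coeFn_smul, -inner_self_eq_norm_sq_to_K,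
    L2.add_apply, L2.smul_apply, ketBra, inner_qket, qket_zero_one, qket_one_zero, qket_self]

theorem hadamardOp_sq : hadamardOp * hadamardOp = 1 := by
  ext1 ψ
  have h2 := inv_sqrt_two_mul_self
  refine qubit_ext ?_ ?_
  all_goals simp [-lp.coeFn_add, -lp.coeFn_sub, -lp.coeFn_smul, -inner_self_eq_norm_sq_to_K,
    L2.add_apply, L2.sub_apply, L2.smul_apply, hadamardOp, ketBra, qplus, qminus, inner_qket, qket_zero_one, qket_one_zero, qket_self]
  · linear_combination (2 * ψ fun _ => 0) * h2
  · linear_combination (2 * ψ fun _ => 1) * h2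

theorem star_hadamardOp : star hadamardOp = hadamardOp := by
  rw [hadamardOp, star_add, star_ketBra, star_ketBra]
  ext1 ψ
  refine qubit_ext ?_ ?_ <;>
  simp [-lp.coeFn_add, -lp.coeFn_sub, -lp.coeFn_smul, -inner_self_eq_norm_sq_to_K,
    L2.add_apply, L2.sub_apply, L2.smul_apply, ketBra, qplus, qminus, inner_qket, qket_zero_one, qket_one_zero, qket_self] <;> ring

/-- The Hadamard operator as a unitary. -/
def hadamard : unitary (Op QubitReg) :=
  ⟨hadamardOp, Unitary.mem_iff.2 ⟨by rw [star_hadamardOp, hadamardOp_sq],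
    by rw [star_hadamardOp, hadamardOp_sq]⟩⟩

theorem isDensity_plus : IsDensity (ketBra qplus qplus) := by
  refine ⟨InnerProductSpace.isPositive_rankOne_self _, ?_⟩
  have h2 := inv_sqrt_two_mul_self
  have h := hasSum_fintype fun x : QubitReg => ketBra qplus qplus (ket x) x
  convert h using 1
  rw [← (Equiv.funUnique (Fin 1) (Fin 2)).symm.sum_comp, Fin.sum_univ_two]
  have e : ∀ b : Fin 2, (Equiv.funUnique (Fin 1) (Fin 2)).symm b = fun _ => b := fun _ => rfl
  rw [e, e]
  change 1 = ketBra qplus qplus (qket 0) _ + ketBra qplus qplus (qket 1) _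
  simp [-lp.coeFn_add, -lp.coeFn_sub, -lp.coeFn_smul, -inner_self_eq_norm_sq_to_K,
    L2.add_apply, L2.smul_apply, ketBra, qplus, inner_qket, qket_zero_one, qket_one_zero, qket_self]
  linear_combination -2 * h2

/-! ### The program with two nested loops -/

/-- The quantum variables: two qubits `q`, `r`, and two registers `t₁`, `t₂` over `ℤ`. -/
inductive ExVar : Type
  | q | r | t₁ | t₂
  deriving DecidableEq

instance : Fintype ExVar := ⟨{.q, .r, .t₁, .t₂}, fun v => by cases v <;> simp⟩

/-- The bases: `H_q = H_r = span{|0⟩, |1⟩}`, and `t₁`, `t₂` have the state space `ℓ²(ℤ)`. -/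
abbrev ExB : ExVar → Type
  | .q => Fin 2
  | .r => Fin 2
  | .t₁ => ℤ
  | .t₂ => ℤ

instance ExB.instZero : ∀ v, Zero (ExB v)
  | .q => inferInstanceAs (Zero (Fin 2))
  | .r => inferInstanceAs (Zero (Fin 2))
  | .t₁ => inferInstanceAs (Zero ℤ)
  | .t₂ => inferInstanceAs (Zero ℤ)

/-- The right translation `R = ∑ⱼ |j+1⟩⟨j|` on a register with one variable over `ℤ`. -/
def shiftUnitary : unitary (Op (Fin 1 → ℤ)) :=
  permUnitary (Equiv.addRight (1 : Fin 1 → ℤ))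

/-- The register `t₁, t₂, q`. -/
abbrev exReg : Fin 3 ↪ ExVar := ⟨![.t₁, .t₂, .q], by decide⟩

/-- The label of `t₁` in `|j, k, b⟩`. -/
def exJ (x : RegConfig ExB exReg) : ℤ := x 0

/-- The label of `t₂` in `|j, k, b⟩`. -/
def exK (x : RegConfig ExB exReg) : ℤ := x 1

/-- The label of `q` in `|j, k, b⟩`. -/
def exBit (x : RegConfig ExB exReg) : Fin 2 := x 2

/-- Replacing the label of `q` by `c`. -/
def exSetBit (x : RegConfig ExB exReg) (c : Fin 2) : RegConfig ExB exReg
  | 0 => exJ x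
  | 1 => exK x
  | 2 => c

open Classical in
/-- The action of `EX` on the basis: `|j, k, b⟩ ↦ |j, k, 1 - b⟩` if `k = 2 ^ j`, and
`|j, k, b⟩ ↦ |j, k, b⟩` otherwise. -/
def exFlip (x : RegConfig ExB exReg) : RegConfig ExB exReg :=
  if (2 : ℚ) ^ exJ x = exK x then exSetBit x (1 - exBit x) else x

theorem exFlip_involutive : Function.Involutive exFlip := by
  intro x
  by_cases h : (2 : ℚ) ^ exJ x = exK x
  · have h1 : exFlip x = exSetBit x (1 - exBit x) := if_pos h
    have h2 : exFlip (exFlip x) = exSetBit (exFlip x) (1 - exBit (exFlip x)) := by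
      refine if_pos ?_
      rw [h1]
      exact h
    have h4 : ∀ b : Fin 2, 1 - (1 - b) = b := by decide
    rw [h2, h1]
    funext i
    match i with
    | 0 => rfl
    | 1 => rfl
    | 2 => exact h4 (exBit x)
  · have h1 : exFlip x = x := if_neg h
    rw [h1, h1]

/-- The unitary `EX`, which flips `q` if `t₁`, `t₂` are in the states `|j⟩`, `|2 ^ j⟩`. -/
def exUnitary : unitary (Op (RegConfig ExB exReg)) := permUnitary exFlip_involutive.toPerm

/-- `while M[q] = 1 do P od` with `M₀ = |1⟩⟨1|`, `M₁ = |0⟩⟨0|`. -/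
def whileQ (P : QProg ExB 1) : QProg ExB 1 :=
  .loop (singleReg .q) (ketBra (qket 1) (qket 1)) (ketBra (qket 0) (qket 0)) qubit_completeness P

/-- The inner loop. -/
def exInner : QProg ExB 1 :=
  whileQ <|
    (QProg.simulate 0 (singleReg .r) (ketBra qplus qplus) isDensity_plus).seq <|
    (QProg.apply (singleReg .t₂) shiftUnitary).seq <|
    QProg.apply exReg exUnitary

/-- The program `P(θ)`. -/
def exProg : QProg ExB 1 :=
  (QProg.init .q).seq <| (QProg.init .t₁).seq <| whileQ <|
    (QProg.apply (singleReg .t₁) shiftUnitary).seq <|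
    (QProg.init .r).seq <| (QProg.init .t₂).seq <|
    exInner.seq <|
    QProg.apply (singleReg .q) hadamard

/-- The initial state, all variables in the state `|0⟩`. -/
def exState : Op (Config ExB) := ketBra (ket 0) (ket 0)

/-- The observable `2|ψ⟩⟨ψ|` on `r`. -/
def exObs : Op (Config ExB) := (2 : ℂ) • onReg (B := ExB) (singleReg .r) (ketBra qpsi qpsi)

/-- The expectation function of the program. -/
def exExpectation (θ : ℝ) : ℝ := exProg.expectation exState exObs fun _ => θ

/-! ### Probabilistic while-programs, and the classical counterpart -/

/-- Probabilistic while-programs over the state space `S`. -/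
inductive PProg (S : Type) : Type
  /-- update the state by `f` -/
  | assign (f : S → S) : PProg S
  /-- update the state by `f` with probability `p`, and by `g` with probability `1 - p` -/
  | choice (p : ℝ≥0∞) (hp : p ≤ 1) (f g : S → S) : PProg S
  /-- `C₁; C₂` -/
  | seq (C₁ C₂ : PProg S) : PProg S
  /-- `while b do C od` -/
  | loop (b : S → Prop) (C : PProg S) : PProg S

open Classical in
/-- For a loop with guard `b` and body kernel `κ`: the probability, started in `s`, that the loop
stops after exactly `n` rounds, in the state `t`. -/
def loopRounds {S : Type} (b : S → Prop) (κ : S → S → ℝ≥0∞) : ℕ → S → S → ℝ≥0∞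
  | 0, s, t => if ¬ b s ∧ t = s then 1 else 0
  | n + 1, s, t => if b s then ∑' u, κ s u * loopRounds b κ n u t else 0

open Classical in
/-- `C.run s t` is the probability that `C`, started in `s`, terminates in `t`. -/
def PProg.run {S : Type} : PProg S → S → S → ℝ≥0∞
  | .assign f, s, t => if t = f s then 1 else 0
  | .choice p _ f g, s, t => (if t = f s then p else 0) + (if t = g s then 1 - p else 0)
  | .seq C₁ C₂, s, t => ∑' u, C₁.run s u * C₂.run u t
  | .loop b C, s, t => ∑' n, loopRounds b C.run n s t

/-- The values of the program variables `q`, `t₁`, `t₂`, `r`. -/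
structure CState : Type where
  q : ℤ
  t₁ : ℤ
  t₂ : ℤ
  r : ℝ

/-- The program `C(θ)`. -/
def classicalProg (θ : ℝ) : PProg CState :=
  (PProg.assign fun s => { s with q := 0 }).seq <|
  (PProg.assign fun s => { s with t₁ := 0 }).seq <|
  PProg.loop (fun s => s.q ≠ 1) <|
    (PProg.assign fun s => { s with t₁ := s.t₁ + 1 }).seq <|
    (PProg.assign fun s => { s with r := 1 }).seq <|
    (PProg.assign fun s => { s with t₂ := 0 }).seq <|
    (PProg.loop (fun s => s.t₂ ≠ s.t₁) <|
      (PProg.assign fun s => { s with r := s.r * 2 }).seq <|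
      PProg.assign fun s => { s with t₂ := s.t₂ + 1 }).seq <|
    (PProg.assign fun s => { s with r := Real.sin (s.r * θ) + 1 }).seq <|
    PProg.choice (1 / 2) (by simp) (fun s => { s with q := 0 }) (fun s => { s with q := 1 })

end

/-! ### A nowhere differentiable lacunary series -/

/-! The program tosses a fair coin after each outer round. In round `j` the inner loop turns `r`
through the angle `2 ^ j * θ`, because `EX` releases the loop exactly when `t₂` reaches `2 ^ j`, and
angles of `e^{-iθ|+⟩⟨+|}` add (`exInner_sem`). Measuring `q` after the Hadamard stops the outer loop
with probability 1/2, so the final state is the mixture of pure states with weights `2^{-j}`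
(`exOuter_sem`). The observable has the value `1 + sin (2 ^ j * θ)` on the `j`-th of them
(`inner_exObs`), and exchanging the sum over the basis with the sum over the mixture
(`hasSum_trace_mixture`) gives `1 + lacunarySine θ`. The probabilistic program has the same
geometric law for the number of rounds, hence the same expectation (`classicalProg_expectation`).

Continuity is uniform convergence. Non-differentiability at `x` comes from a finite difference `∑ pᵢ
g (x + i h)`, whose coefficients are those of a polynomial `p`. On a sine of frequency `ω` it
reduces to the values of `p` at `e^{±iωh}` (`sum_coeff_mul_sin`), so the roots of `p` decide which
frequencies are seen. With `p = (1 - X)^4 (1 + X) (X + i)` and `h = 2π / 2^(m+3)`, frequencies above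
`2^(m+1)` have phase `-1` or `1` and vanish. The frequency `2^(m+1)` has phases `i` and `-i`, of
which only `i` is not a root. Lower frequencies are small because the root `1` has order four. Hence
the difference is at least `2^{-m}` (`le_norm_probe`). If the series were differentiable at `x`, the
double root of `p` at `1` would make the difference `o(h)` (`hasDerivAt_probe`), whereas `h = (π/4)
2^{-m} < 2^{-m}`. -/

open Polynomial in
theorem sum_coeff_mul_sin (p : ℂ[X]) (a b : ℂ) :
    ∑ i ∈ Finset.range (p.natDegree + 1), p.coeff i * Complex.sin (a + i * b) =
      (Complex.exp (a * Complex.I) * p.eval (Complex.exp (b * Complex.I)) -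
        Complex.exp (-a * Complex.I) * p.eval (Complex.exp (-b * Complex.I))) /
          (2 * Complex.I) := by
  rw [eval_eq_sum_range, eval_eq_sum_range, Finset.mul_sum, Finset.mul_sum,
    ← Finset.sum_sub_distrib, Finset.sum_div]
  refine Finset.sum_congr rfl fun i _ => ?_
  rw [← Complex.exp_nat_mul, ← Complex.exp_nat_mul, Complex.sin]
  have e1 : Complex.exp ((a + i * b) * Complex.I) =
      Complex.exp (a * Complex.I) * Complex.exp (i * (b * Complex.I)) := by
    rw [← Complex.exp_add]; ring_nf
  have e2 : Complex.exp (-(a + i * b) * Complex.I) =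
      Complex.exp (-a * Complex.I) * Complex.exp (i * (-b * Complex.I)) := by
    rw [← Complex.exp_add]; ring_nf
  rw [e1, e2, eq_div_iff (by simp)]
  linear_combination (p.coeff i * (Complex.exp (-a * Complex.I) *
    Complex.exp (i * (-b * Complex.I)) - Complex.exp (a * Complex.I) *
    Complex.exp (i * (b * Complex.I)))) * Complex.I_sq

/-- The series `∑ 2⁻ᵏ sin(2ᵏ x)`, `k ≥ 1`. -/
noncomputable def lacunarySine (x : ℝ) : ℝ :=
  ∑' k : ℕ, (1 / 2 : ℝ) ^ (k + 1) * Real.sin (2 ^ (k + 1) * x)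

theorem summable_half_pow_succ : Summable fun k : ℕ => (1 / 2 : ℝ) ^ (k + 1) :=
  (summable_nat_add_iff 1).2 summable_geometric_two

theorem norm_lacunarySine_term_le (x : ℝ) (k : ℕ) :
    ‖(1 / 2 : ℝ) ^ (k + 1) * Real.sin (2 ^ (k + 1) * x)‖ ≤ (1 / 2 : ℝ) ^ (k + 1) := by
  rw [norm_mul, Real.norm_of_nonneg (by positivity)]
  exact mul_le_of_le_one_right (by positivity) (Real.abs_sin_le_one _)

theorem hasSum_lacunarySine (x : ℝ) :
    HasSum (fun k : ℕ => (1 / 2 : ℝ) ^ (k + 1) * Real.sin (2 ^ (k + 1) * x)) (lacunarySine x) :=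
  (Summable.of_norm_bounded summable_half_pow_succ (norm_lacunarySine_term_le x)).hasSum

theorem continuous_lacunarySine : Continuous lacunarySine :=
  continuous_tsum (fun k => by fun_prop) summable_half_pow_succ
    fun k x => norm_lacunarySine_term_le x k

open Polynomial in
/-- A polynomial that vanishes at `1` to the order four, and at `-1` and `-i`. -/
noncomputable def probePoly : ℂ[X] := (1 - X) ^ 4 * (1 + X) * (X + C Complex.I)

open Polynomial in
theorem probePoly_eval (w : ℂ) :
    probePoly.eval w = (1 - w) ^ 4 * (1 + w) * (w + Complex.I) := by
  simp [probePoly]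

-- In the difference `∑ pᵢ g (x + i h)` the value `g x` has coefficient `p 1` and the slope at `x`
-- has coefficient `p' 1`; both must vanish for the difference to be `o(h)`.
open Polynomial in
theorem probePoly_derivative_eval_one : probePoly.derivative.eval 1 = 0 := by
  simp [probePoly, derivative_mul, derivative_pow]

/-- A chord is at most its arc, which bounds each of the four factors `1 - w` by `|t|`; the other
two factors are at most 2. -/
theorem norm_probePoly_eval_exp_le (t : ℝ) :
    ‖probePoly.eval (Complex.exp (t * Complex.I))‖ ≤ 4 * t ^ 4 := by
  have h1 : ‖1 - Complex.exp (t * Complex.I)‖ ≤ |t| := by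
    rw [norm_sub_rev, mul_comm]
    exact Real.norm_exp_I_mul_ofReal_sub_one_le
  have hw := Complex.norm_exp_ofReal_mul_I t
  have h2 : ‖1 + Complex.exp (t * Complex.I)‖ ≤ 2 := by
    refine (norm_add_le _ _).trans ?_
    rw [hw, norm_one]; norm_num
  have h3 : ‖Complex.exp (t * Complex.I) + Complex.I‖ ≤ 2 := by
    refine (norm_add_le _ _).trans ?_
    rw [hw, Complex.norm_I]; norm_num
  rw [probePoly_eval, norm_mul, norm_mul, norm_pow]
  calc _ ≤ |t| ^ 4 * 2 * 2 := by gcongr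
    _ = 4 * t ^ 4 := by rw [(by decide : Even 4).pow_abs]; ring

/-- The combination of the values of `2⁻ᵏ sin(2ᵏ y)` at `y = x + i h` with the coefficients of
`probePoly`. -/
noncomputable def probeTerm (x h : ℝ) (k : ℕ) : ℂ :=
  ∑ i ∈ Finset.range (probePoly.natDegree + 1), probePoly.coeff i *
    (((1 / 2 : ℝ) ^ (k + 1) * Real.sin (2 ^ (k + 1) * (x + i * h)) : ℝ) : ℂ)

/-- The combination of the values of `lacunarySine` at `x + i h` with the coefficients of
`probePoly`. -/
noncomputable def probe (x h : ℝ) : ℂ :=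
  ∑ i ∈ Finset.range (probePoly.natDegree + 1), probePoly.coeff i * (lacunarySine (x + i * h) : ℂ)

theorem hasSum_probeTerm (x h : ℝ) : HasSum (probeTerm x h) (probe x h) :=
  hasSum_sum fun i _ => (Complex.hasSum_ofReal.2 (hasSum_lacunarySine (x + i * h))).mul_left _

theorem probeTerm_eq (x h : ℝ) (k : ℕ) :
    probeTerm x h k = (1 / 2 : ℂ) ^ (k + 1) *
      ((Complex.exp ((2 ^ (k + 1) * x : ℝ) * Complex.I) *
          probePoly.eval (Complex.exp ((2 ^ (k + 1) * h : ℝ) * Complex.I)) -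
        Complex.exp ((-(2 ^ (k + 1) * x) : ℝ) * Complex.I) *
          probePoly.eval (Complex.exp ((-(2 ^ (k + 1) * h) : ℝ) * Complex.I))) /
          (2 * Complex.I)) := by
  have := sum_coeff_mul_sin probePoly (2 ^ (k + 1) * x : ℝ) (2 ^ (k + 1) * h : ℝ)
  push_cast at this ⊢
  rw [← this, probeTerm, Finset.mul_sum]
  refine Finset.sum_congr rfl fun i _ => ?_
  push_cast
  ring_nf

/-- The weight `2^{-(k+1)}` against the fourth power of the frequency `2^(k+1)` leaves `8^(k+1)`.
This growth makes the sum over low frequencies comparable to its last term. -/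
theorem norm_probeTerm_le (x h : ℝ) (k : ℕ) : ‖probeTerm x h k‖ ≤ 4 * 8 ^ (k + 1) * h ^ 4 := by
  rw [probeTerm_eq, norm_mul, norm_div, norm_mul, Complex.norm_I, norm_pow]
  have h1 := norm_probePoly_eval_exp_le (2 ^ (k + 1) * h)
  have h2 := norm_probePoly_eval_exp_le (-(2 ^ (k + 1) * h))
  have h3 := norm_sub_le (Complex.exp ((2 ^ (k + 1) * x : ℝ) * Complex.I) *
          probePoly.eval (Complex.exp ((2 ^ (k + 1) * h : ℝ) * Complex.I)))
        (Complex.exp ((-(2 ^ (k + 1) * x) : ℝ) * Complex.I) *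
          probePoly.eval (Complex.exp ((-(2 ^ (k + 1) * h) : ℝ) * Complex.I)))
  rw [norm_mul, norm_mul, Complex.norm_exp_ofReal_mul_I, Complex.norm_exp_ofReal_mul_I] at h3
  have e : (-(2 ^ (k + 1) * h)) ^ 4 = (2 ^ (k + 1) * h) ^ 4 := by ring
  rw [e] at h2
  have h4 : ‖(1 / 2 : ℂ)‖ ^ (k + 1) * (2 ^ (k + 1)) ^ 4 = 8 ^ (k + 1) := by
    rw [← pow_mul, mul_comm (k + 1) 4, pow_mul, ← mul_pow]
    norm_num
  have h5 : ‖(2 : ℂ)‖ = 2 := by simp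
  rw [h5]
  calc _ ≤ ‖(1 / 2 : ℂ)‖ ^ (k + 1) * ((8 * (2 ^ (k + 1) * h) ^ 4) / (2 * 1)) := by
        gcongr; linarith
    _ = 4 * (‖(1 / 2 : ℂ)‖ ^ (k + 1) * (2 ^ (k + 1)) ^ 4) * h ^ 4 := by ring
    _ = _ := by rw [h4]

/-- The step at which the frequencies above `2 ^ (m + 1)` are invisible. -/
noncomputable def probeStep (m : ℕ) : ℝ := 2 * Real.pi / 2 ^ (m + 3)

theorem two_pow_mul_probeStep (m l : ℕ) :
    (2 : ℝ) ^ (m + 2 + l + 1) * probeStep m = (2 ^ l : ℕ) * (2 * Real.pi) := by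
  rw [probeStep]
  field_simp
  push_cast
  ring

/-- For `k = m + 1` the phase is a half turn, and `-1` is a root of the polynomial; for larger `k`
it is a whole number of turns, and `1` is a root. -/
theorem probeTerm_eq_zero (x : ℝ) (m k : ℕ) (hk : m + 1 ≤ k) :
    probeTerm x (probeStep m) k = 0 := by
  obtain rfl | hk := hk.eq_or_lt
  · have e : (2 : ℝ) ^ (m + 1 + 1) * probeStep m = Real.pi := by
      rw [probeStep]; field_simp; ring
    rw [probeTerm_eq, e, Complex.ofReal_neg, neg_mul, Complex.exp_neg, Complex.exp_pi_mul_I]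
    simp [probePoly_eval]
  · obtain ⟨l, rfl⟩ := Nat.exists_eq_add_of_lt hk
    have e : (2 : ℝ) ^ (m + 1 + l + 1 + 1) * probeStep m = (2 ^ l : ℕ) * (2 * Real.pi) := by
      rw [← two_pow_mul_probeStep]; ring_nf
    have e' : Complex.exp (((2 ^ l : ℕ) * (2 * Real.pi) : ℝ) * Complex.I) = 1 := by
      have := Complex.exp_nat_mul_two_pi_mul_I (2 ^ l)
      rw [← this]; push_cast; ring_nf
    rw [probeTerm_eq, e, Complex.ofReal_neg (_ * (2 * Real.pi)),
      neg_mul (Complex.ofReal (_ * (2 * Real.pi))), Complex.exp_neg, e']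
    simp [probePoly_eval]

/-- The phases are `i` and `-i`. Since `-i` is a root, only one of the two exponentials survives;
nothing can cancel, and the modulus `|p(i)| / 2 = 8√2 / 2` does not depend on `x`. -/
theorem norm_probeTerm_self (x : ℝ) (m : ℕ) :
    ‖probeTerm x (probeStep m) m‖ = (1 / 2) ^ (m + 1) * (4 * √2) := by
  have e : (2 : ℝ) ^ (m + 1) * probeStep m = Real.pi / 2 := by
    rw [probeStep]; field_simp; ring
  have e1 : Complex.exp ((Real.pi / 2 : ℝ) * Complex.I) = Complex.I := by
    push_cast; exact Complex.exp_pi_div_two_mul_I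
  have e2 : probePoly.eval Complex.I = 8 * (1 - Complex.I) := by
    rw [probePoly_eval]
    ring_nf
    simp only [show Complex.I ^ 6 = -1 by
        rw [show 6 = 2 * 3 by rfl, pow_mul, Complex.I_sq]; norm_num,
      show Complex.I ^ 5 = Complex.I by rw [Complex.I_pow_eq_pow_mod]; simp,
      Complex.I_pow_four, Complex.I_pow_three, Complex.I_sq]
    ring
  have e3 : probePoly.eval (Complex.I)⁻¹ = 0 := by simp [probePoly_eval]
  rw [probeTerm_eq, e, Complex.ofReal_neg (Real.pi / 2), neg_mul, Complex.exp_neg, e1, e2, e3,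
    mul_zero, sub_zero, norm_mul, norm_div, norm_mul, norm_mul, norm_mul, Complex.norm_I, norm_pow,
    Complex.norm_exp_ofReal_mul_I]
  have h1 : ‖1 - Complex.I‖ = √2 := by
    rw [Complex.norm_def]; congr 1; simp [Complex.normSq_apply]; norm_num
  rw [h1]
  norm_num
  ring

theorem le_norm_probe (x : ℝ) (m : ℕ) : (1 / 2) ^ m ≤ ‖probe x (probeStep m)‖ := by
  have hs : probe x (probeStep m) = ∑ k ∈ Finset.range (m + 1), probeTerm x (probeStep m) k :=
    (hasSum_probeTerm _ _).unique (hasSum_sum_of_ne_finset_zero fun k hk =>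
      probeTerm_eq_zero x m k (by simpa using hk))
  rw [hs, Finset.sum_range_succ]
  have h1 : ‖∑ k ∈ Finset.range m, probeTerm x (probeStep m) k‖ ≤
      (1 / 2) ^ (m + 1) * (Real.pi ^ 4 / 28) := by
    calc _ ≤ ∑ k ∈ Finset.range m, 4 * 8 ^ (k + 1) * probeStep m ^ 4 :=
          norm_sum_le_of_le _ fun k _ => norm_probeTerm_le _ _ _
      _ = 32 * ((8 ^ m - 1) / (8 - 1)) * probeStep m ^ 4 := by
          rw [← geom_sum_eq (by norm_num), Finset.mul_sum, Finset.sum_mul]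
          exact Finset.sum_congr rfl fun k _ => by ring
      _ ≤ 32 * (8 ^ m / 7) * probeStep m ^ 4 := by gcongr <;> linarith
      _ = (1 / 2) ^ (m + 1) * (Real.pi ^ 4 / 28) := by
          have h8 : (8 : ℝ) ^ m = (2 ^ m) ^ 3 := by rw [← pow_mul, mul_comm, pow_mul]; norm_num
          rw [probeStep, h8, one_div, inv_pow]
          field_simp
          ring
  have h2 := norm_probeTerm_self x m
  have h3 : ‖probeTerm x (probeStep m) m‖ ≤
      ‖∑ k ∈ Finset.range m, probeTerm x (probeStep m) k + probeTerm x (probeStep m) m‖ +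
        ‖∑ k ∈ Finset.range m, probeTerm x (probeStep m) k‖ := by
    have := norm_sub_le (∑ k ∈ Finset.range m, probeTerm x (probeStep m) k +
      probeTerm x (probeStep m) m) (∑ k ∈ Finset.range m, probeTerm x (probeStep m) k)
    rwa [add_sub_cancel_left] at this
  have h4 : Real.pi ^ 4 ≤ 3.15 ^ 4 := by
    gcongr; exact Real.pi_lt_d2.le
  have h5 : 1.41 ≤ √2 := Real.le_sqrt_of_sq_le (by norm_num)
  -- `4√2 - π⁴/28` is about `5.66 - 3.48`, which exceeds the factor 2 needed to turn `2^{-(m+1)}`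
  -- into `2^{-m}`.
  have h6 : (1 / 2 : ℝ) ^ (m + 1) * 2 ≤ (1 / 2) ^ (m + 1) * (4 * √2 - Real.pi ^ 4 / 28) := by
    gcongr
    norm_num at h4
    linarith
  rw [pow_succ] at *
  linarith

open Polynomial in
theorem hasDerivAt_probe {x d : ℝ} (hd : HasDerivAt lacunarySine d x) :
    HasDerivAt (probe x) 0 0 := by
  have h1 : ∀ i : ℕ, HasDerivAt (fun h : ℝ => ((lacunarySine (x + i * h) : ℝ) : ℂ))
      ((d * i : ℝ) : ℂ) 0 := fun i => by
    have hin : HasDerivAt (fun h : ℝ => x + i * h) (i : ℝ) 0 := by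
      simpa using ((hasDerivAt_id (0 : ℝ)).const_mul (i : ℝ)).const_add x
    have hd' : HasDerivAt lacunarySine d (x + i * 0) := by simpa using hd
    exact (hd'.comp (0 : ℝ) hin).ofReal_comp
  have h2 : HasDerivAt (probe x) (∑ i ∈ Finset.range (probePoly.natDegree + 1),
      probePoly.coeff i * ((d * i : ℝ) : ℂ)) 0 :=
    HasDerivAt.fun_sum fun i _ => (h1 i).const_mul _
  convert h2 using 1
  have h3 := probePoly_derivative_eval_one
  rw [derivative_eval, sum_over_range _ (by simp)] at h3
  simp only [one_pow, mul_one] at h3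
  calc (0 : ℂ) = d * 0 := by simp
    _ = _ := by
      rw [← h3, Finset.mul_sum]
      refine Finset.sum_congr rfl fun i _ => ?_
      push_cast; ring

open Polynomial in
theorem probe_zero (x : ℝ) : probe x 0 = 0 := by
  have h : probePoly.eval 1 = 0 := by simp [probePoly_eval]
  rw [eval_eq_sum_range] at h
  simp only [one_pow, mul_one] at h
  simp only [probe, mul_zero, add_zero, ← Finset.sum_mul, h, zero_mul]

theorem not_differentiableAt_lacunarySine (x : ℝ) : ¬ DifferentiableAt ℝ lacunarySine x := by
  intro hd
  have h1 := (hasDerivAt_probe hd.hasDerivAt).isLittleO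
  simp only [probe_zero, sub_zero, smul_zero] at h1
  have h2 : Filter.Tendsto probeStep Filter.atTop (nhds 0) := by
    have : probeStep = fun m => 2 * Real.pi / 2 ^ 3 * (1 / 2) ^ m := by
      funext m
      rw [probeStep, one_div, inv_pow, pow_add]
      field_simp
    have h := (tendsto_pow_atTop_nhds_zero_of_lt_one (r := (1 / 2 : ℝ)) (by norm_num)
      (by norm_num)).const_mul (2 * Real.pi / 2 ^ 3)
    rwa [mul_zero, ← this] at h
  -- The constant 1 in the little-o is small enough, since `probeStep m = (π/4) 2^{-m}` and `π < 4`.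
  obtain ⟨m, hm⟩ := (h2.eventually (h1.def (c := 1) one_pos)).exists
  have h3 := (le_norm_probe x m).trans hm
  rw [one_mul, Real.norm_of_nonneg (by rw [probeStep]; positivity), probeStep, one_div, inv_pow,
    pow_add, inv_eq_one_div, div_le_div_iff₀ (by positivity) (by positivity)] at h3
  have h4 : (0 : ℝ) < 2 ^ m := by positivity
  nlinarith [Real.pi_lt_d2]

/-! ### The probabilistic program -/

theorem PProg.run_assign_seq {S : Type} (f : S → S) (C : PProg S) (s : S) :
    ((PProg.assign f).seq C).run s = C.run (f s) := by
  classical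
  funext t
  simp only [PProg.run]
  rw [tsum_eq_single (f s) fun u hu => by rw [if_neg hu, zero_mul], if_pos rfl, one_mul]

open Classical in
/-- The point mass at `s`. -/
noncomputable def pointMass {S : Type} (s t : S) : ℝ≥0∞ := if t = s then 1 else 0

theorem PProg.run_assign {S : Type} (f : S → S) (s : S) :
    (PProg.assign f).run s = pointMass (f s) := rfl

theorem tsum_pointMass_mul {S : Type} (s : S) (g : S → ℝ≥0∞) :
    ∑' u, pointMass s u * g u = g s := by
  rw [tsum_eq_single s fun u hu => by rw [pointMass, if_neg hu, zero_mul], pointMass, if_pos rfl,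
    one_mul]

theorem PProg.run_seq_of_pointMass {S : Type} {C₁ : PProg S} {s u : S}
    (h : C₁.run s = pointMass u) (C₂ : PProg S) : (C₁.seq C₂).run s = C₂.run u := by
  funext t
  simp only [PProg.run, h]
  exact tsum_pointMass_mul u _

theorem loopRounds_of_not {S : Type} {b : S → Prop} (κ : S → S → ℝ≥0∞) {s : S} (hs : ¬ b s)
    (n : ℕ) (t : S) : loopRounds b κ n s t = if n = 0 then pointMass s t else 0 := by
  cases n with
  | zero => classical simp [loopRounds, pointMass, hs]
  | succ n => simp [loopRounds, hs]

/-- A loop whose body is deterministic along the first `m` rounds. -/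
theorem loopRounds_of_iterate {S : Type} {b : S → Prop} {κ : S → S → ℝ≥0∞} {f : S → S} {m : ℕ} :
    ∀ {s : S}, (∀ i < m, b (f^[i] s)) → ¬ b (f^[m] s) →
      (∀ i < m, κ (f^[i] s) = pointMass (f^[i + 1] s)) → ∀ n t,
      loopRounds b κ n s t = if n = m then pointMass (f^[m] s) t else 0 := by
  induction m with
  | zero => exact fun _ h _ n t => loopRounds_of_not κ h n t
  | succ m ih =>
    intro s hb hn hκ n t
    have hs : b s := hb 0 m.succ_pos
    cases n with
    | zero => simp [loopRounds, hs]
    | succ n =>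
      have h0 : κ s = pointMass (f s) := hκ 0 m.succ_pos
      simp only [loopRounds, if_pos hs, h0, tsum_pointMass_mul]
      rw [ih (s := f s) (fun i hi => hb (i + 1) (by omega)) hn
        (fun i hi => hκ (i + 1) (by omega))]
      simp

theorem PProg.run_loop_of_iterate {S : Type} {b : S → Prop} {C : PProg S} {f : S → S} {m : ℕ}
    {s : S} (hb : ∀ i < m, b (f^[i] s)) (hn : ¬ b (f^[m] s))
    (hκ : ∀ i < m, C.run (f^[i] s) = pointMass (f^[i + 1] s)) :
    (PProg.loop b C).run s = pointMass (f^[m] s) := by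
  funext t
  simp only [PProg.run, loopRounds_of_iterate hb hn hκ, tsum_ite_eq]

/-- The bound `t₁ = j` is a natural number, so `t₂`, counting up from 0, meets it after `j`
doublings. -/
theorem classical_inner_run (j : ℕ) (q : ℤ) (r : ℝ) :
    (PProg.loop (fun s : CState => s.t₂ ≠ s.t₁) <|
      (PProg.assign fun s => { s with r := s.r * 2 }).seq <|
      PProg.assign fun s => { s with t₂ := s.t₂ + 1 }).run ⟨q, j, 0, r⟩ =
      pointMass ⟨q, j, j, r * 2 ^ j⟩ := by
  set f : CState → CState := fun s => { s with r := s.r * 2, t₂ := s.t₂ + 1 } with hf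
  have hit : ∀ i : ℕ, f^[i] ⟨q, j, 0, r⟩ = ⟨q, j, i, r * 2 ^ i⟩ := fun i => by
    induction i with
    | zero => simp
    | succ i ih =>
      rw [Function.iterate_succ_apply', ih, hf]
      simp [pow_succ, mul_assoc]
  rw [PProg.run_loop_of_iterate (f := f) (m := j), hit]
  · intro i hi
    rw [hit]
    simpa using hi.ne
  · rw [hit]; simp
  · intro i _
    rw [PProg.run_assign_seq, PProg.run_assign, Function.iterate_succ_apply']

/-- The final state of the probabilistic program after `j` rounds. -/
noncomputable def cFinal (θ : ℝ) (q : ℤ) (j : ℕ) : CState := ⟨q, j, j, Real.sin (2 ^ j * θ) + 1⟩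

/-- The body of the outer loop of the probabilistic program. -/
noncomputable def classicalBody (θ : ℝ) : PProg CState :=
    (PProg.assign fun s => { s with t₁ := s.t₁ + 1 }).seq <|
    (PProg.assign fun s => { s with r := 1 }).seq <|
    (PProg.assign fun s => { s with t₂ := 0 }).seq <|
    (PProg.loop (fun s => s.t₂ ≠ s.t₁) <|
      (PProg.assign fun s => { s with r := s.r * 2 }).seq <|
      PProg.assign fun s => { s with t₂ := s.t₂ + 1 }).seq <|
    (PProg.assign fun s => { s with r := Real.sin (s.r * θ) + 1 }).seq <|
    PProg.choice (1 / 2) (by simp) (fun s => { s with q := 0 }) (fun s => { s with q := 1 })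

/-- All variables except `t₁` are overwritten before they matter, so the result depends on `j`
alone. -/
theorem classicalBody_run (θ : ℝ) (q : ℤ) (j : ℕ) (k : ℤ) (r : ℝ) (t : CState) :
    (classicalBody θ).run ⟨q, j, k, r⟩ t =
      1 / 2 * pointMass (cFinal θ 0 (j + 1)) t + 1 / 2 * pointMass (cFinal θ 1 (j + 1)) t := by
  have h := classical_inner_run (j + 1) q 1
  rw [Nat.cast_succ] at h
  rw [classicalBody, PProg.run_assign_seq, PProg.run_assign_seq, PProg.run_assign_seq,
    PProg.run_seq_of_pointMass h, PProg.run_assign_seq]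
  classical
  simp only [PProg.run, pointMass, cFinal, one_mul, Nat.cast_succ, mul_ite, mul_one, mul_zero,
    one_div, ENNReal.one_sub_inv_two]

theorem classical_rounds (θ : ℝ) (n : ℕ) : ∀ (j : ℕ) (k : ℤ) (r : ℝ) (t : CState),
    loopRounds (fun s : CState => s.q ≠ 1) (classicalBody θ).run n ⟨0, j, k, r⟩ t =
      if n = 0 then 0 else (1 / 2) ^ n * pointMass (cFinal θ 1 (j + n)) t := by
  induction n with
  | zero => intros; simp [loopRounds]
  | succ n ih =>
    intro j k r t
    rw [loopRounds, if_pos (by norm_num)]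
    simp only [classicalBody_run, add_mul, mul_assoc]
    rw [ENNReal.tsum_add, ENNReal.tsum_mul_left, ENNReal.tsum_mul_left, tsum_pointMass_mul,
      tsum_pointMass_mul, loopRounds_of_not (s := cFinal θ 1 (j + 1)) _ (by simp [cFinal]), cFinal,
      ih, if_neg n.succ_ne_zero]
    -- If no further round is to follow, only the branch `q = 1` contributes; otherwise only the
    -- branch `q = 0` does.
    obtain rfl | hn := eq_or_ne n 0
    · simp
    · rw [if_neg hn, if_neg hn, mul_zero, add_zero, pow_succ', mul_assoc, add_assoc, add_comm 1 n]

theorem classicalProg_run (θ : ℝ) (s t : CState) :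
    (classicalProg θ).run s t =
      ∑' n : ℕ, (1 / 2) ^ (n + 1) * pointMass (cFinal θ 1 (n + 1)) t := by
  rw [classicalProg, PProg.run_assign_seq, PProg.run_assign_seq]
  change ∑' n, loopRounds _ (classicalBody θ).run n ⟨0, (0 : ℕ), _, _⟩ t = _
  simp only [classical_rounds, zero_add]
  -- The term for zero rounds vanishes, since `q = 0` forces a first round.
  rw [tsum_eq_zero_add' ENNReal.summable]
  simp

theorem cFinal_injective (θ : ℝ) (q : ℤ) : Function.Injective (cFinal θ q) := fun i j h => by
  simpa [cFinal] using congrArg CState.t₁ h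

/-- The possible final states are distinguished by `t₁`, so the sum over the uncountable state space
reduces to a sum over the number of rounds. -/
theorem classicalProg_expectation (θ : ℝ) (s : CState) {a : ℝ}
    (h : HasSum (fun n : ℕ => (1 / 2 : ℝ) ^ (n + 1) * (Real.sin (2 ^ (n + 1) * θ) + 1)) a) :
    HasSum (fun t => ((classicalProg θ).run s t).toReal * t.r) a := by
  have hinj : Function.Injective fun n => cFinal θ 1 (n + 1) :=
    (cFinal_injective θ 1).comp (add_left_injective 1)
  rw [← hinj.hasSum_iff]
  · convert h using 2 with n
    have : (classicalProg θ).run s (cFinal θ 1 (n + 1)) = (1 / 2) ^ (n + 1) := by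
      rw [classicalProg_run, tsum_eq_single n, pointMass, if_pos rfl, mul_one]
      intro m hm
      rw [pointMass, if_neg (fun e => hm (hinj e).symm), mul_zero]
    simp only [Function.comp_apply, this]
    simp [cFinal]
  · intro t ht
    have : (classicalProg θ).run s t = 0 := by
      rw [classicalProg_run, ENNReal.tsum_eq_zero]
      intro n
      rw [pointMass, if_neg (fun e => ht ⟨n, e.symm⟩), mul_zero]
    rw [this]; simp

/-! ### Operators on basis vectors -/

open Classical in
theorem slice_ket {X Y Z : Type} (e : X ≃ Y × Z) (x : X) (z : Z) :
    L2.slice e (ket x) z = if z = (e x).2 then ket (e x).1 else 0 := by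
  ext y
  change ket x (e.symm (y, z)) = _
  rw [ket_apply, Equiv.symm_apply_eq]
  split_ifs with h1 h2 h2
  · rw [ket_apply, if_pos (by rw [← h1])]
  · exact absurd (by rw [← h1]) h2
  · rw [ket_apply, if_neg fun h => h1 (Prod.ext h h2)]
  · rfl

open Classical in
theorem ampliate_ket_apply {X Y Z : Type} (e : X ≃ Y × Z) (A : Op Y) (x y : X) :
    ampliate e A (ket x) y = if (e y).2 = (e x).2 then A (ket (e x).1) (e y).1 else 0 := by
  change A (L2.slice e (ket x) (e y).2) (e y).1 = _
  rw [slice_ket]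
  split_ifs with h
  · rfl
  · rw [map_zero]; rfl

open Classical in
theorem ket_symm_apply {X Y Z : Type} (e : X ≃ Y × Z) (w : Y) (z : Z) (y : X) :
    ket (e.symm (w, z)) y = if (e y).2 = z then ket w (e y).1 else 0 := by
  rw [ket_apply, ket_apply, Equiv.eq_symm_apply, Prod.ext_iff]
  split_ifs <;> simp_all

/-- Two kets suffice: every operator in the program and the observable maps a basis ket of its
register to a combination of at most two. -/
theorem ampliate_ket {X Y Z : Type} (e : X ≃ Y × Z) {A : Op Y} {x : X} {c d : ℂ} {w w' : Y}
    (h : A (ket (e x).1) = c • ket w + d • ket w') :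
    ampliate e A (ket x) = c • ket (e.symm (w, (e x).2)) + d • ket (e.symm (w', (e x).2)) := by
  ext y
  rw [ampliate_ket_apply, h, L2.add_apply, L2.add_apply, L2.smul_apply, L2.smul_apply,
    L2.smul_apply, L2.smul_apply, ket_symm_apply, ket_symm_apply]
  split_ifs <;> simp

theorem ampliate_ket_single {X Y Z : Type} (e : X ≃ Y × Z) {A : Op Y} {x : X} {c : ℂ} {w : Y}
    (h : A (ket (e x).1) = c • ket w) :
    ampliate e A (ket x) = c • ket (e.symm (w, (e x).2)) := by
  have := ampliate_ket (w' := w) (c := c) (d := 0) e (A := A) (x := x)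
    (by rw [h, zero_smul, add_zero])
  rwa [zero_smul, add_zero] at this

theorem permUnitary_ket {X : Type} (e : X ≃ X) (x : X) :
    (permUnitary e : Op X) (ket x) = ket (e x) := by
  ext y
  change ket x (e.symm y) = _
  rw [ket_apply, ket_apply, Equiv.symm_apply_eq]

theorem ketBra_apply {X : Type} (a b ψ : L2 X) : ketBra a b ψ = (inner ℂ b ψ) • a := by
  simp [ketBra]

theorem regSplit_symm_single {V : Type} [DecidableEq V] (B : V → Type) (q : V) (x : Config B)
    (y : RegConfig B (singleReg q)) :
    (regSplit B (singleReg q)).symm (y, (regSplit B (singleReg q) x).2) =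
      Function.update x q (y 0) := by
  rw [Equiv.symm_apply_eq]
  refine Prod.ext (funext fun i => ?_) (funext fun v => ?_)
  · rw [Subsingleton.elim i 0]
    exact (Function.update_self q (y 0) x).symm
  · exact (Function.update_of_ne (fun h => v.2 ⟨0, h.symm⟩) _ _).symm

/-- The operator `c |v⟩⟨v|`. -/
noncomputable def pureState {X : Type} (c : ℝ) (v : L2 X) : Op X := (c : ℂ) • ketBra v v

/-- From `K|v⟩⟨v|K† = |Kv⟩⟨Kv|`; unitary statements and measurement branches can then be followed on
vectors. -/
theorem sandwich_pureState {X : Type} (K : Op X) (c : ℝ) (v : L2 X) :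
    sandwich K (pureState c v) = pureState c (K v) := by
  rw [sandwich, pureState, mul_smul_comm, smul_mul_assoc, pureState]
  congr 1
  ext1 ψ
  simp [ketBra, ContinuousLinearMap.star_eq_adjoint, ContinuousLinearMap.adjoint_inner_right]

theorem sandwich_zero {X : Type} (K : Op X) : sandwich K 0 = 0 := by simp [sandwich]

theorem pureState_zero {X : Type} (c : ℝ) : pureState c (0 : L2 X) = 0 := by
  simp [pureState, ketBra]

theorem pureState_smul {X : Type} (c : ℝ) (a : ℂ) (v : L2 X) :
    pureState c (a • v) = pureState (c * ‖a‖ ^ 2) v := by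
  ext1 ψ
  simp only [pureState, smul_apply, ketBra_apply, smul_smul, inner_smul_left]
  congr 1
  push_cast
  rw [← Complex.conj_mul']
  ring

/-! ### Traces and least upper bounds of mixtures -/

theorem hasSum_apply {X J : Type} {f : J → L2 X} {ψ : L2 X} (h : HasSum f ψ) (x : X) :
    HasSum (fun j => f j x) (ψ x) := by
  simpa only [innerSL_apply_apply, inner_ket] using h.mapL (innerSL ℂ (ket x))

theorem norm_ketBra {X : Type} (v w : L2 X) : ‖ketBra v w‖ = ‖v‖ * ‖w‖ := by
  simp [ketBra]

theorem summable_mixture {X J : Type} {c : J → ℝ} {v : J → L2 X} (hc : Summable c)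
    (h0 : ∀ j, 0 ≤ c j) (hv : ∀ j, ‖v j‖ = 1) : Summable fun j => pureState (c j) (v j) :=
  Summable.of_norm_bounded hc fun j => by
    rw [pureState, norm_smul, norm_ketBra, hv, Complex.norm_real, Real.norm_of_nonneg (h0 j)]
    simp

theorem hasSum_conj_mul {X : Type} (ψ φ : L2 X) :
    HasSum (fun x => (starRingEnd ℂ) (ψ x) * φ x) (inner ℂ ψ φ) := by
  have h := lp.hasSum_inner (𝕜 := ℂ) ψ φ
  simp only [RCLike.inner_apply] at h
  simpa only [mul_comm] using h

/-- The trace of `A T` for a mixture `T` of pure states. -/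
theorem hasSum_trace_mixture {X J : Type} {c : J → ℝ} {v : J → L2 X} (hc : Summable c)
    (h0 : ∀ j, 0 ≤ c j) (hv : ∀ j, ‖v j‖ = 1) {T : Op X}
    (hT : HasSum (fun j => pureState (c j) (v j)) T) (A : Op X) {a : ℂ}
    (ha : HasSum (fun j => (c j : ℂ) * inner ℂ (v j) (A (v j))) a) :
    HasSum (fun x => (A * T) (ket x) x) a := by
  set G : J × X → ℂ := fun p => (c p.1 : ℂ) * ((starRingEnd ℂ) (v p.1 p.2) * A (v p.1) p.2) with hG
  have hrow : ∀ j, HasSum (fun x => G (j, x)) ((c j : ℂ) * inner ℂ (v j) (A (v j))) := fun j =>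
    (hasSum_conj_mul (v j) (A (v j))).mul_left _
  -- A majorant from `|ab| ≤ |a|² + |b|²`. Its row sums are at most `c j * (1 + ‖A‖²)`, which gives
  -- the absolute convergence needed to exchange the two sums.
  set N : J × X → ℝ := fun p => c p.1 * (‖v p.1 p.2‖ ^ 2 + ‖A (v p.1) p.2‖ ^ 2) with hN
  have hNrow : ∀ j, HasSum (fun x => N (j, x)) (c j * (‖v j‖ ^ 2 + ‖A (v j)‖ ^ 2)) := fun j =>
    ((L2.hasSum_sq (v j)).add (L2.hasSum_sq (A (v j)))).mul_left _
  have hNs : Summable N := by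
    refine (summable_prod_of_nonneg fun p => mul_nonneg (h0 _) (by positivity)).2
      ⟨fun j => (hNrow j).summable, ?_⟩
    refine Summable.congr ?_ fun j => (hNrow j).tsum_eq.symm
    refine Summable.of_nonneg_of_le (fun j => mul_nonneg (h0 _) (by positivity)) (fun j => ?_)
      (hc.mul_right (1 ^ 2 + (‖A‖ * 1) ^ 2))
    have h1 := A.le_opNorm (v j)
    rw [hv] at h1 ⊢
    have := h0 j
    gcongr
  have hGs : Summable G := by
    refine Summable.of_norm_bounded hNs fun p => ?_
    rw [hG, hN]
    simp only [norm_mul, Complex.norm_real, Real.norm_of_nonneg (h0 _), RCLike.norm_conj]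
    refine mul_le_mul_of_nonneg_left ?_ (h0 _)
    nlinarith [sq_nonneg (‖v p.1 p.2‖ - ‖A (v p.1) p.2‖), sq_nonneg ‖v p.1 p.2‖,
      sq_nonneg ‖A (v p.1) p.2‖]
  have hGa : HasSum G a := by
    have h1 := hGs.hasSum
    rwa [(h1.prod_fiberwise hrow).unique ha] at h1
  have hcol : ∀ x, HasSum (fun j => G (j, x)) ((A * T) (ket x) x) := fun x => by
    have h1 : HasSum (fun j => A (pureState (c j) (v j) (ket x))) ((A * T) (ket x)) :=
      (hT.mapL (ContinuousLinearMap.apply ℂ (L2 X) (ket x))).mapL A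
    convert hasSum_apply h1 x using 2 with j
    rw [hG, pureState, smul_apply, map_smul, ketBra_apply, map_smul,
      L2.smul_apply, L2.smul_apply, ← inner_conj_symm, inner_ket]
  have hswap : HasSum (fun p : X × J => G (p.2, p.1)) a :=
    ((Equiv.prodComm X J).hasSum_iff (f := G)).2 hGa
  exact hswap.prod_fiberwise hcol

theorem isPositive_pureState {X : Type} {c : ℝ} (hc : 0 ≤ c) (v : L2 X) : 0 ≤ pureState c v := by
  rw [pureState]
  have h : (0 : Op X) ≤ ketBra v v := by
    rw [ContinuousLinearMap.nonneg_iff_isPositive]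
    exact InnerProductSpace.isPositive_rankOne_self _
  rw [ContinuousLinearMap.nonneg_iff_isPositive] at h ⊢
  exact h.smul_of_nonneg (Complex.zero_le_real.2 hc)

theorem isPartialDensity_mixture {X J : Type} {c : J → ℝ} {v : J → L2 X} {t : ℝ} (hc : HasSum c t)
    (ht : t ≤ 1) (h0 : ∀ j, 0 ≤ c j) (hv : ∀ j, ‖v j‖ = 1) {T : Op X}
    (hT : HasSum (fun j => pureState (c j) (v j)) T) : IsPartialDensity T := by
  refine ⟨?_, t, ht, ?_⟩
  · rw [← ContinuousLinearMap.nonneg_iff_isPositive]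
    exact hT.nonneg fun j => isPositive_pureState (h0 j) (v j)
  · have h := hasSum_trace_mixture hc.summable h0 hv hT 1 (a := t) (by
      convert Complex.hasSum_ofReal.2 hc using 2 with j
      simp [hv])
    rwa [one_mul] at h

theorem isPartialDensity_pureState {X : Type} {c : ℝ} (h0 : 0 ≤ c) (h1 : c ≤ 1) {v : L2 X}
    (hv : ‖v‖ = 1) : IsPartialDensity (pureState c v) :=
  isPartialDensity_mixture (J := Unit) (c := fun _ => c) (v := fun _ => v) (t := c)
    (by simp) h1 (fun _ => h0) (fun _ => hv)
    (by simp)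

/-- The least upper bound of the partial sums of a mixture. -/
theorem isLoewnerLub_mixture {X : Type} {c : ℕ → ℝ} {v : ℕ → L2 X} {t : ℝ} (hc : HasSum c t)
    (ht : t ≤ 1) (h0 : ∀ j, 0 ≤ c j) (hv : ∀ j, ‖v j‖ = 1) {T : Op X}
    (hT : HasSum (fun j => pureState (c j) (v j)) T) :
    IsLoewnerLub (fun n => ∑ j ∈ Finset.range n, pureState (c j) (v j)) T :=
  ⟨isPartialDensity_mixture hc ht h0 hv hT,
    fun _ => sum_le_hasSum _ (fun j _ => isPositive_pureState (h0 j) (v j)) hT,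
    -- The Löwner order is closed in the norm topology, so an upper bound of the partial sums also
    -- bounds their limit.
    fun _ _ h => le_of_tendsto' hT.tendsto_sum_nat h⟩

/-- The least upper bound of a sequence that jumps from `0` to `T`. -/
theorem isLoewnerLub_jump {X : Type} {T : Op X} (hT : IsPartialDensity T) (m : ℕ) :
    IsLoewnerLub (fun n => if n < m then 0 else T) T := by
  refine ⟨hT, fun n => ?_, fun T' _ h => by simpa using h m⟩
  have h0 : 0 ≤ T := (ContinuousLinearMap.nonneg_iff_isPositive T).2 hT.1
  beta_reduce
  split_ifs
  · exact h0
  · exact le_rfl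

/-- The exponential of a multiple of a projection. -/
theorem exp_smul_of_idempotent {X : Type} {P : Op X} (hP : P * P = P) (c : ℂ) :
    NormedSpace.exp (c • P) = 1 + (Complex.exp c - 1) • P := by
  have h1 : HasSum (fun n : ℕ => ((n.factorial : ℂ)⁻¹ * c ^ n) • P) (Complex.exp c • P) := by
    have := NormedSpace.exp_series_hasSum_exp' (𝕂 := ℂ) c
    rw [← Complex.exp_eq_exp_ℂ] at this
    exact this.smul_const P
  have h2 : HasSum (fun n : ℕ => if n = 0 then 1 - P else 0) (1 - P) := hasSum_ite_eq 0 (1 - P)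
  have h3 := NormedSpace.exp_series_hasSum_exp' (𝕂 := ℂ) (c • P)
  have h4 := h1.add h2
  -- All powers of `P` equal `P` except `P ^ 0 = 1`, whence the correction `1 - P` at `n = 0`.
  have h5 : (fun n : ℕ => (n.factorial : ℂ)⁻¹ • (c • P) ^ n) =
      fun n => ((n.factorial : ℂ)⁻¹ * c ^ n) • P + if n = 0 then 1 - P else 0 := by
    funext n
    cases n with
    | zero => simp
    | succ n =>
      have : P ^ (n + 1) = P := by
        induction n with
        | zero => simp
        | succ n ih => rw [pow_succ, ih, hP]
      rw [smul_pow, this, smul_smul]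
      simp
  rw [h5] at h3
  rw [h3.unique h4, sub_smul, one_smul]
  abel

/-! ### The states of the quantum program -/

/-- The basis label with the given values of `q`, `r`, `t₁`, `t₂`. -/
def exCfg (a b : Fin 2) (j k : ℤ) : Config ExB
  | .q => a
  | .r => b
  | .t₁ => j
  | .t₂ => k

theorem exCfg_injective {a b a' b' : Fin 2} {j k j' k' : ℤ} (h : exCfg a b j k = exCfg a' b' j' k') :
    a = a' ∧ b = b' ∧ j = j' ∧ k = k' :=
  ⟨congrFun h .q, congrFun h .r, congrFun h .t₁, congrFun h .t₂⟩

theorem update_exCfg_q (a b : Fin 2) (j k : ℤ) (c : Fin 2) :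
    Function.update (exCfg a b j k) .q c = exCfg c b j k := by
  funext v; cases v <;> rfl

theorem update_exCfg_r (a b : Fin 2) (j k : ℤ) (c : Fin 2) :
    Function.update (exCfg a b j k) .r c = exCfg a c j k := by
  funext v; cases v <;> rfl

theorem update_exCfg_t₁ (a b : Fin 2) (j k : ℤ) (c : ℤ) :
    Function.update (exCfg a b j k) .t₁ c = exCfg a b c k := by
  funext v; cases v <;> rfl

theorem update_exCfg_t₂ (a b : Fin 2) (j k : ℤ) (c : ℤ) :
    Function.update (exCfg a b j k) .t₂ c = exCfg a b j c := by
  funext v; cases v <;> rfl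

theorem onReg_single_ket {V : Type} [DecidableEq V] {B : V → Type} {q : V}
    {A : Op (RegConfig B (singleReg q))} {x : Config B} {c d : ℂ} {w w' : RegConfig B (singleReg q)}
    (h : A (ket fun i => x (singleReg q i)) = c • ket w + d • ket w') :
    onReg (singleReg q) A (ket x) =
      c • ket (Function.update x q (w 0)) + d • ket (Function.update x q (w' 0)) := by
  rw [onReg, ampliate_ket (regSplit B (singleReg q)) h, regSplit_symm_single, regSplit_symm_single]

theorem onReg_single_ket' {V : Type} [DecidableEq V] {B : V → Type} {q : V}
    {A : Op (RegConfig B (singleReg q))} {x : Config B} {c : ℂ} {w : RegConfig B (singleReg q)}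
    (h : A (ket fun i => x (singleReg q i)) = c • ket w) :
    onReg (singleReg q) A (ket x) = c • ket (Function.update x q (w 0)) := by
  rw [onReg, ampliate_ket_single (regSplit B (singleReg q)) h, regSplit_symm_single]

theorem onReg_transition_ket {V : Type} [DecidableEq V] {B : V → Type} {q : V}
    (w n : RegConfig B (singleReg q)) (x : Config B) [Decidable ((fun i => x (singleReg q i)) = n)] :
    onReg (singleReg q) (ketBra (ket w) (ket n)) (ket x) =
      if (fun i => x (singleReg q i)) = n then ket (Function.update x q (w 0)) else 0 := by
  have h : ketBra (ket w) (ket n) (ket fun i => x (singleReg q i)) =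
      (if (fun i => x (singleReg q i)) = n then (1 : ℂ) else 0) • ket w := by
    rw [ketBra_apply, inner_ket, ket_apply]
    by_cases h0 : (fun i => x (singleReg q i)) = n
    · rw [if_pos h0, if_pos h0.symm]
    · rw [if_neg h0, if_neg fun h => h0 h.symm]
  rw [onReg_single_ket' h]
  split_ifs <;> simp

/-- The vector with `r` in the state `φ₀|0⟩ + φ₁|1⟩` and the other variables in basis states. -/
noncomputable def exVec (a : Fin 2) (φ : Fin 2 → ℂ) (j k : ℤ) : L2 (Config ExB) :=
  φ 0 • ket (exCfg a 0 j k) + φ 1 • ket (exCfg a 1 j k)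

theorem map_exVec (A : Op (Config ExB)) (a : Fin 2) (φ : Fin 2 → ℂ) (j k : ℤ) :
    A (exVec a φ j k) = φ 0 • A (ket (exCfg a 0 j k)) + φ 1 • A (ket (exCfg a 1 j k)) := by
  rw [exVec, map_add, map_smul, map_smul]

theorem onReg_transition_q (w n : Fin 2) (a : Fin 2) (φ : Fin 2 → ℂ) (j k : ℤ) :
    onReg (B := ExB) (singleReg .q) (ketBra (qket w) (qket n)) (exVec a φ j k) =
      if a = n then exVec w φ j k else 0 := by
  classical
  have h : ∀ b, onReg (B := ExB) (singleReg .q) (ketBra (qket w) (qket n)) (ket (exCfg a b j k)) =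
      if a = n then ket (exCfg w b j k) else 0 := fun b => by
    refine (onReg_transition_ket (B := ExB) (q := .q) (fun _ => w) (fun _ => n) _).trans ?_
    rw [update_exCfg_q]
    exact if_congr ⟨fun h => congrFun h 0, fun h => funext fun _ => h⟩ rfl rfl
  rw [map_exVec, h, h]
  split_ifs
  · rfl
  · simp

theorem onReg_transition_t₁ (w n : ℤ) (a : Fin 2) (φ : Fin 2 → ℂ) (j k : ℤ) :
    onReg (B := ExB) (singleReg .t₁) (ketBra (ket fun _ => w) (ket fun _ => n)) (exVec a φ j k) =
      if j = n then exVec a φ w k else 0 := by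
  classical
  have h : ∀ b, onReg (B := ExB) (singleReg .t₁) (ketBra (ket fun _ => w) (ket fun _ => n))
      (ket (exCfg a b j k)) = if j = n then ket (exCfg a b w k) else 0 := fun b => by
    refine (onReg_transition_ket (B := ExB) (q := .t₁) (fun _ => w) (fun _ => n) _).trans ?_
    rw [update_exCfg_t₁]
    exact if_congr ⟨fun h => congrFun h 0, fun h => funext fun _ => h⟩ rfl rfl
  rw [map_exVec, h, h]
  split_ifs
  · rfl
  · simp

theorem onReg_transition_t₂ (w n : ℤ) (a : Fin 2) (φ : Fin 2 → ℂ) (j k : ℤ) :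
    onReg (B := ExB) (singleReg .t₂) (ketBra (ket fun _ => w) (ket fun _ => n)) (exVec a φ j k) =
      if k = n then exVec a φ j w else 0 := by
  classical
  have h : ∀ b, onReg (B := ExB) (singleReg .t₂) (ketBra (ket fun _ => w) (ket fun _ => n))
      (ket (exCfg a b j k)) = if k = n then ket (exCfg a b j w) else 0 := fun b => by
    refine (onReg_transition_ket (B := ExB) (q := .t₂) (fun _ => w) (fun _ => n) _).trans ?_
    rw [update_exCfg_t₂]
    exact if_congr ⟨fun h => congrFun h 0, fun h => funext fun _ => h⟩ rfl rfl
  rw [map_exVec, h, h]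
  split_ifs
  · rfl
  · simp

theorem onReg_transition_r (w n : Fin 2) (a : Fin 2) (φ : Fin 2 → ℂ) (j k : ℤ) :
    onReg (B := ExB) (singleReg .r) (ketBra (qket w) (qket n)) (exVec a φ j k) =
      φ n • ket (exCfg a w j k) := by
  classical
  have h : ∀ b, onReg (B := ExB) (singleReg .r) (ketBra (qket w) (qket n)) (ket (exCfg a b j k)) =
      if b = n then ket (exCfg a w j k) else 0 := fun b => by
    refine (onReg_transition_ket (B := ExB) (q := .r) (fun _ => w) (fun _ => n) _).trans ?_
    rw [update_exCfg_r]
    exact if_congr ⟨fun h => congrFun h 0, fun h => funext fun _ => h⟩ rfl rfl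
  rw [map_exVec, h, h]
  fin_cases n <;> simp

theorem onReg_shift_t₁ (a : Fin 2) (φ : Fin 2 → ℂ) (j k : ℤ) :
    onReg (B := ExB) (singleReg .t₁) (shiftUnitary : Op (Fin 1 → ℤ)) (exVec a φ j k) =
      exVec a φ (j + 1) k := by
  have h : ∀ b, onReg (B := ExB) (singleReg .t₁) (shiftUnitary : Op (Fin 1 → ℤ))
      (ket (exCfg a b j k)) = ket (exCfg a b (j + 1) k) := fun b => by
    refine (onReg_single_ket' (B := ExB) (q := .t₁) (c := 1) (w := fun _ => j + 1) ?_).trans ?_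
    · rw [one_smul]
      exact permUnitary_ket _ _
    · rw [one_smul, update_exCfg_t₁]
  rw [map_exVec, h, h, exVec]

theorem onReg_shift_t₂ (a : Fin 2) (φ : Fin 2 → ℂ) (j k : ℤ) :
    onReg (B := ExB) (singleReg .t₂) (shiftUnitary : Op (Fin 1 → ℤ)) (exVec a φ j k) =
      exVec a φ j (k + 1) := by
  have h : ∀ b, onReg (B := ExB) (singleReg .t₂) (shiftUnitary : Op (Fin 1 → ℤ))
      (ket (exCfg a b j k)) = ket (exCfg a b j (k + 1)) := fun b => by
    refine (onReg_single_ket' (B := ExB) (q := .t₂) (c := 1) (w := fun _ => k + 1) ?_).trans ?_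
    · rw [one_smul]
      exact permUnitary_ket _ _
    · rw [one_smul, update_exCfg_t₂]
  rw [map_exVec, h, h, exVec]

/-- Only nonnegative labels are reached, and for them the rational condition in `exFlip` is an
equation in `ℕ`. -/
theorem onReg_exUnitary (a : Fin 2) (φ : Fin 2 → ℂ) (j k : ℕ) :
    onReg exReg (exUnitary : Op (RegConfig ExB exReg)) (exVec a φ j k) =
      if k = 2 ^ j then exVec (1 - a) φ j k else exVec a φ j k := by
  have h : ∀ b, onReg exReg (exUnitary : Op (RegConfig ExB exReg)) (ket (exCfg a b j k)) =
      if k = 2 ^ j then ket (exCfg (1 - a) b j k) else ket (exCfg a b j k) := fun b => by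
    refine (ampliate_ket_single (regSplit ExB exReg) (c := 1)
      (w := exFlip (regSplit ExB exReg (exCfg a b j k)).1) ?_).trans ?_
    · rw [one_smul]
      exact permUnitary_ket _ _
    · rw [one_smul]
      have hc : ((2 : ℚ) ^ exJ (regSplit ExB exReg (exCfg a b j k)).1 =
          exK (regSplit ExB exReg (exCfg a b j k)).1) ↔ k = 2 ^ j := by
        change (2 : ℚ) ^ (j : ℤ) = ((k : ℤ) : ℚ) ↔ _
        rw [zpow_natCast, Int.cast_natCast, eq_comm]
        exact_mod_cast Iff.rfl
      rw [exFlip]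
      split_ifs with h1 h2 h2
      · congr 1
        rw [Equiv.symm_apply_eq]
        refine Prod.ext (funext fun i => ?_) (funext fun v => ?_)
        · match i with
          | 0 => rfl
          | 1 => rfl
          | 2 => rfl
        · obtain ⟨v, hv⟩ := v
          cases v with
          | q => exact absurd ⟨2, rfl⟩ hv
          | r => rfl
          | t₁ => rfl
          | t₂ => rfl
      · exact absurd (hc.1 h1) h2
      · exact absurd (hc.2 h2) h1
      · rw [Prod.mk.eta, Equiv.symm_apply_apply]
  rw [map_exVec, h, h]
  split_ifs <;> rfl

/-- The state `e^{-iα|+⟩⟨+|}|0⟩` of a qubit. -/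
noncomputable def rotPhi (α : ℝ) : Fin 2 → ℂ :=
  ![(Complex.exp (-(Complex.I * α)) + 1) / 2, (Complex.exp (-(Complex.I * α)) - 1) / 2]

theorem ketBra_qplus_sq : ketBra qplus qplus * ketBra qplus qplus = ketBra qplus qplus := by
  have h2 := inv_sqrt_two_mul_self
  have h : inner ℂ qplus qplus = (1 : ℂ) := by
    rw [qplus, inner_smul_left, inner_add_left, inner_qket, inner_qket]
    simp [-lp.coeFn_add, -lp.coeFn_smul, L2.add_apply, L2.smul_apply, qket_zero_one, qket_one_zero,
      qket_self]
    linear_combination 2 * h2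
  ext1 ψ
  change ketBra qplus qplus (ketBra qplus qplus ψ) = _
  rw [ketBra_apply, ketBra_apply, inner_smul_right, h, mul_one]

theorem ketBra_qplus_qket (b : Fin 2) :
    ketBra qplus qplus (qket b) = (1 / 2 : ℂ) • qket 0 + (1 / 2 : ℂ) • qket 1 := by
  have h2 := inv_sqrt_two_mul_self
  have h : inner ℂ qplus (qket b) = ((√2 : ℝ) : ℂ)⁻¹ := by
    rw [qplus, inner_smul_left, inner_add_left, inner_qket, inner_qket]
    fin_cases b <;> simp [qket_zero_one, qket_one_zero, qket_self]
  rw [ketBra_apply, h, qplus, smul_smul, h2, smul_add]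

/-- The exponential is `1 + (e^{-iθ} - 1)|+⟩⟨+|`, and all entries of `|+⟩⟨+|` are 1/2. It commutes
with exchanging `|0⟩` and `|1⟩`, hence the index `1 - b`. -/
theorem rotation_qket (θ : ℝ) (b : Fin 2) :
    NormedSpace.exp ((-(Complex.I * (θ : ℂ))) • ketBra qplus qplus) (qket b) =
      (rotPhi θ b) • qket 0 + (rotPhi θ (1 - b)) • qket 1 := by
  rw [exp_smul_of_idempotent ketBra_qplus_sq]
  change qket b + (_ : ℂ) • ketBra qplus qplus (qket b) = _
  rw [ketBra_qplus_qket]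
  fin_cases b
  · simp only [rotPhi, Fin.zero_eta, sub_zero, Matrix.cons_val_zero, Matrix.cons_val_one]
    module
  · simp only [rotPhi, Fin.mk_one, sub_self, Matrix.cons_val_zero, Matrix.cons_val_one]
    module

theorem onReg_rotation (θ α : ℝ) (a : Fin 2) (j k : ℤ) :
    onReg (B := ExB) (singleReg .r)
      (NormedSpace.exp ((-(Complex.I * (θ : ℂ))) • ketBra qplus qplus)) (exVec a (rotPhi α) j k) =
      exVec a (rotPhi (α + θ)) j k := by
  have h : ∀ b, onReg (B := ExB) (singleReg .r)
      (NormedSpace.exp ((-(Complex.I * (θ : ℂ))) • ketBra qplus qplus)) (ket (exCfg a b j k)) =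
      (rotPhi θ b) • ket (exCfg a 0 j k) + (rotPhi θ (1 - b)) • ket (exCfg a 1 j k) := fun b => by
    refine (onReg_single_ket (B := ExB) (q := .r) (rotation_qket θ b)).trans ?_
    rw [update_exCfg_r, update_exCfg_r]
  have he : Complex.exp (-(Complex.I * (α + θ : ℝ))) =
      Complex.exp (-(Complex.I * α)) * Complex.exp (-(Complex.I * θ)) := by
    rw [← Complex.exp_add]; push_cast; ring_nf
  rw [map_exVec, h, h, exVec]
  simp only [rotPhi, sub_zero, sub_self, Matrix.cons_val_zero, Matrix.cons_val_one, he]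
  module

theorem hadamardOp_qket_one :
    hadamardOp (qket 1) = ((√2 : ℝ) : ℂ)⁻¹ • qket 0 + (-((√2 : ℝ) : ℂ)⁻¹) • qket 1 := by
  change ketBra qplus (qket 0) (qket 1) + ketBra qminus (qket 1) (qket 1) = _
  rw [ketBra_apply, ketBra_apply, inner_qket, inner_qket, qket_one_zero, qket_self, qminus]
  module

theorem onReg_hadamard_one (φ : Fin 2 → ℂ) (j k : ℤ) :
    onReg (B := ExB) (singleReg .q) (hadamard : Op QubitReg) (exVec 1 φ j k) =
      ((√2 : ℝ) : ℂ)⁻¹ • exVec 0 φ j k + (-((√2 : ℝ) : ℂ)⁻¹) • exVec 1 φ j k := by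
  have h : ∀ b, onReg (B := ExB) (singleReg .q) (hadamard : Op QubitReg) (ket (exCfg 1 b j k)) =
      ((√2 : ℝ) : ℂ)⁻¹ • ket (exCfg 0 b j k) + (-((√2 : ℝ) : ℂ)⁻¹) • ket (exCfg 1 b j k) :=
    fun b => by
      refine (onReg_single_ket (B := ExB) (q := .q) hadamardOp_qket_one).trans ?_
      rw [update_exCfg_q, update_exCfg_q]
  rw [map_exVec, h, h, exVec, exVec]
  module

theorem inner_exVec (a : Fin 2) (φ : Fin 2 → ℂ) (j k : ℤ) (ψ : L2 (Config ExB)) :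
    inner ℂ (exVec a φ j k) ψ = (starRingEnd ℂ) (φ 0) * ψ (exCfg a 0 j k) +
      (starRingEnd ℂ) (φ 1) * ψ (exCfg a 1 j k) := by
  rw [exVec, inner_add_left, inner_smul_left, inner_smul_left, inner_ket, inner_ket]

theorem exVec_apply (a b : Fin 2) (φ : Fin 2 → ℂ) (j k : ℤ) : exVec a φ j k (exCfg a b j k) = φ b := by
  have h01 : exCfg a 0 j k ≠ exCfg a 1 j k := fun h => absurd (exCfg_injective h).2.1 (by decide)
  rw [exVec, L2.add_apply, L2.smul_apply, L2.smul_apply, ket_apply, ket_apply]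
  fin_cases b
  · simp [h01]
  · simp [h01.symm]

theorem norm_exVec {a : Fin 2} {φ : Fin 2 → ℂ} (hφ : ‖φ 0‖ ^ 2 + ‖φ 1‖ ^ 2 = 1) (j k : ℤ) :
    ‖exVec a φ j k‖ = 1 := by
  have h := inner_self_eq_norm_sq_to_K (𝕜 := ℂ) (exVec a φ j k)
  rw [inner_exVec, exVec_apply, exVec_apply, Complex.conj_mul', Complex.conj_mul'] at h
  have h1 : ‖exVec a φ j k‖ ^ 2 = 1 := by
    rw [← hφ]
    apply Complex.ofReal_injective
    push_cast
    exact h.symm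
  exact (pow_eq_one_iff_of_nonneg (norm_nonneg _) two_ne_zero).1 h1

theorem norm_rotPhi (α : ℝ) : ‖rotPhi α 0‖ ^ 2 + ‖rotPhi α 1‖ ^ 2 = 1 := by
  have h : ‖Complex.exp (-(Complex.I * α))‖ = 1 := by
    have := Complex.norm_exp_ofReal_mul_I (-α)
    rw [← this]; push_cast; ring_nf
  have h1 : ‖Complex.exp (-(Complex.I * α)) + 1‖ ^ 2 + ‖Complex.exp (-(Complex.I * α)) - 1‖ ^ 2 =
      4 := by
    have := parallelogram_law_with_norm ℝ (Complex.exp (-(Complex.I * α))) 1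
    rw [h, norm_one] at this
    linarith
  simp only [rotPhi, Matrix.cons_val_zero, Matrix.cons_val_one, norm_div, div_pow]
  norm_num
  linarith

/-! ### The semantics of the quantum program -/

theorem QProg.sem_apply {V : Type} {B : V → Type} [∀ v, Zero (B v)] {k : ℕ} (θ : Fin k → ℝ) {n : ℕ}
    (r : Fin n ↪ V) (U : unitary (Op (RegConfig B r))) (c : ℝ) (v : L2 (Config B)) :
    (QProg.apply (k := k) r U).sem θ (pureState c v) = pureState c (onReg r U v) :=
  sandwich_pureState _ _ _

/-- The body of the inner loop. -/
noncomputable def exInnerBody : QProg ExB 1 :=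
    (QProg.simulate 0 (singleReg .r) (ketBra qplus qplus) isDensity_plus).seq <|
    (QProg.apply (singleReg .t₂) shiftUnitary).seq <|
    QProg.apply exReg exUnitary

theorem exInnerBody_sem_zero (θ : Fin 1 → ℝ) : exInnerBody.sem θ 0 = 0 := by
  simp only [exInnerBody, QProg.sem, sandwich_zero]

theorem exInnerBody_sem (θ : ℝ) (c α : ℝ) (j k : ℕ) :
    exInnerBody.sem (fun _ => θ) (pureState c (exVec 0 (rotPhi α) j k)) =
      pureState c (exVec (if k + 1 = 2 ^ j then 1 else 0) (rotPhi (α + θ)) j (k + 1 : ℕ)) := by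
  simp only [exInnerBody, QProg.sem, sandwich_pureState]
  rw [onReg_rotation, onReg_shift_t₂]
  have := onReg_exUnitary 0 (rotPhi (α + θ)) j (k + 1)
  push_cast at this ⊢
  rw [this]
  split_ifs <;> rfl

/-- Covers a loop whose output all arises after exactly `m` rounds: the partial sums are 0 up to
that point and `T` from then on. -/
theorem loop_sem_of_jump {V : Type} {B : V → Type} [∀ v, Zero (B v)] {k n : ℕ} (θ : Fin k → ℝ)
    (r : Fin n ↪ V) (M₀ M₁ : Op (RegConfig B r)) (hM : star M₀ * M₀ + star M₁ * M₁ = 1)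
    (P : QProg B k) (ρ T : Op (Config B)) (hT : IsPartialDensity T) (m : ℕ)
    (h : ∀ i, sandwich (onReg r M₀) ((fun τ => P.sem θ (sandwich (onReg r M₁) τ))^[i] ρ) =
      if i = m then T else 0) :
    (QProg.loop r M₀ M₁ hM P).sem θ ρ = T := by
  rw [QProg.sem]
  refine IsLoewnerLub.eq_loewnerLub ?_
  convert isLoewnerLub_jump hT m using 2 with n
  simp only [h, Finset.sum_ite_eq', Finset.mem_range]
  split_ifs <;> first | rfl | omega

/-- After `i ≤ 2 ^ j` rounds `t₂` is `|i⟩` and `r` is turned by `i * θ`, while `q` stays `|0⟩` until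
`EX` flips it at `i = 2 ^ j`. The exit branch vanishes before that round; after it, the continuing
branch does. -/
theorem exInner_sem (θ : ℝ) {c : ℝ} (h0 : 0 ≤ c) (h1 : c ≤ 1) (j : ℕ) :
    exInner.sem (fun _ => θ) (pureState c (exVec 0 (rotPhi 0) j 0)) =
      pureState c (exVec 1 (rotPhi (2 ^ j * θ)) j (2 ^ j : ℕ)) := by
  have hstep : ∀ i ≤ 2 ^ j, (fun τ => exInnerBody.sem (fun _ => θ)
      (sandwich (onReg (B := ExB) (singleReg .q) (ketBra (qket 0) (qket 0))) τ))^[i]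
        (pureState c (exVec 0 (rotPhi 0) j 0)) =
      pureState c (exVec (if i = 2 ^ j then 1 else 0) (rotPhi (i * θ)) j i) := by
    intro i
    induction i with
    | zero =>
      intro _
      rw [if_neg (by positivity)]
      simp
    | succ i ih =>
      intro hi
      rw [Function.iterate_succ_apply', ih (by omega), if_neg (by omega)]
      rw [sandwich_pureState, onReg_transition_q, if_pos rfl, exInnerBody_sem]
      congr 3
      push_cast
      ring
  have hzero : ∀ i, (fun τ => exInnerBody.sem (fun _ => θ)
      (sandwich (onReg (B := ExB) (singleReg .q) (ketBra (qket 0) (qket 0))) τ))^[2 ^ j + 1 + i]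
        (pureState c (exVec 0 (rotPhi 0) j 0)) = 0 := by
    intro i
    induction i with
    | zero =>
      rw [add_zero, Function.iterate_succ_apply', hstep _ le_rfl, if_pos rfl, sandwich_pureState,
        onReg_transition_q, if_neg (by decide), pureState_zero, exInnerBody_sem_zero]
    | succ i ih =>
      rw [← add_assoc, Function.iterate_succ_apply', ih, sandwich_zero, exInnerBody_sem_zero]
  refine loop_sem_of_jump _ _ _ _ _ exInnerBody _ _
    (isPartialDensity_pureState h0 h1 (norm_exVec (norm_rotPhi _) _ _)) (2 ^ j) fun i => ?_
  obtain hi | hi := le_or_gt i (2 ^ j)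
  · rw [hstep i hi, sandwich_pureState]
    refine (congrArg _ (onReg_transition_q _ _ _ _ _ _)).trans ?_
    split_ifs with h2 h3 h3
    · rw [h2]; push_cast; rfl
    · exact absurd h3 (by decide)
    · exact absurd h3 (by decide)
    · exact pureState_zero c
  · obtain ⟨l, rfl⟩ := Nat.exists_eq_add_of_le hi
    rw [if_neg (by omega), ← sandwich_zero]
    exact congrArg _ (hzero l)

/-- Since `r` is not entangled with the other variables, both branches of the reset give the same
pure state, and their weights add up to 1. The other variables are in basis states, so that their
resets have a single nonzero branch. -/
theorem init_r_sem (θ : Fin 1 → ℝ) (c : ℝ) (a : Fin 2) {φ : Fin 2 → ℂ}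
    (hφ : ‖φ 0‖ ^ 2 + ‖φ 1‖ ^ 2 = 1) (j k : ℤ) :
    (QProg.init .r : QProg ExB 1).sem θ (pureState c (exVec a φ j k)) =
      pureState c (exVec a (rotPhi 0) j k) := by
  have hv : exVec a (rotPhi 0) j k = ket (exCfg a 0 j k) := by
    rw [exVec]
    simp [rotPhi]
  rw [QProg.sem]
  refine ((Equiv.funUnique (Fin 1) (Fin 2)).symm.tsum_eq (fun n : RegConfig ExB (singleReg .r) =>
    sandwich (onReg (B := ExB) (singleReg .r) (ketBra (ket 0) (ket n)))
      (pureState c (exVec a φ j k)))).symm.trans ?_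
  rw [tsum_fintype, Fin.sum_univ_two]
  have h : ∀ n : Fin 2, sandwich (onReg (B := ExB) (singleReg .r) (ketBra (ket 0)
      (ket ((Equiv.funUnique (Fin 1) (Fin 2)).symm n)))) (pureState c (exVec a φ j k)) =
      pureState (c * ‖φ n‖ ^ 2) (ket (exCfg a 0 j k)) := fun n => by
    rw [← pureState_smul, sandwich_pureState]
    exact congrArg _ (onReg_transition_r 0 n a φ j k)
  refine (congrArg₂ _ (h 0) (h 1)).trans ?_
  rw [hv, pureState, pureState, pureState, ← add_smul]
  congr 1
  rw [← Complex.ofReal_add, ← mul_add, hφ, mul_one]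

theorem init_q_sem (θ : Fin 1 → ℝ) (c : ℝ) (a : Fin 2) (φ : Fin 2 → ℂ) (j k : ℤ) :
    (QProg.init .q : QProg ExB 1).sem θ (pureState c (exVec a φ j k)) =
      pureState c (exVec 0 φ j k) := by
  have h : ∀ n : Fin 2, sandwich (onReg (B := ExB) (singleReg .q) (ketBra (ket 0)
      (ket fun _ => n))) (pureState c (exVec a φ j k)) =
      pureState c (if a = n then exVec 0 φ j k else 0) := fun n => by
    rw [sandwich_pureState]
    exact congrArg _ (onReg_transition_q 0 n a φ j k)
  rw [QProg.sem]
  refine (tsum_eq_single (β := RegConfig ExB (singleReg .q)) (fun _ => a) ?_).trans ?_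
  · intro n hn
    obtain ⟨n, rfl⟩ : ∃ m : Fin 2, n = fun _ => m := ⟨n 0, funext fun i => by
      rw [Subsingleton.elim i 0]⟩
    rw [h, if_neg (fun e => hn (by rw [e])), pureState_zero]
  · rw [h, if_pos rfl]

theorem init_t₁_sem (θ : Fin 1 → ℝ) (c : ℝ) (a : Fin 2) (φ : Fin 2 → ℂ) (j k : ℤ) :
    (QProg.init .t₁ : QProg ExB 1).sem θ (pureState c (exVec a φ j k)) =
      pureState c (exVec a φ 0 k) := by
  have h : ∀ n : ℤ, sandwich (onReg (B := ExB) (singleReg .t₁) (ketBra (ket 0)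
      (ket fun _ => n))) (pureState c (exVec a φ j k)) =
      pureState c (if j = n then exVec a φ 0 k else 0) := fun n => by
    rw [sandwich_pureState]
    exact congrArg _ (onReg_transition_t₁ 0 n a φ j k)
  rw [QProg.sem]
  refine (tsum_eq_single (β := RegConfig ExB (singleReg .t₁)) (fun _ => j) ?_).trans ?_
  · intro n hn
    obtain ⟨n, rfl⟩ : ∃ m : ℤ, n = fun _ => m := ⟨n 0, funext fun i => by
      rw [Subsingleton.elim i 0]⟩
    rw [h, if_neg (fun e => hn (by rw [e])), pureState_zero]
  · rw [h, if_pos rfl]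

theorem init_t₂_sem (θ : Fin 1 → ℝ) (c : ℝ) (a : Fin 2) (φ : Fin 2 → ℂ) (j k : ℤ) :
    (QProg.init .t₂ : QProg ExB 1).sem θ (pureState c (exVec a φ j k)) =
      pureState c (exVec a φ j 0) := by
  have h : ∀ n : ℤ, sandwich (onReg (B := ExB) (singleReg .t₂) (ketBra (ket 0)
      (ket fun _ => n))) (pureState c (exVec a φ j k)) =
      pureState c (if k = n then exVec a φ j 0 else 0) := fun n => by
    rw [sandwich_pureState]
    exact congrArg _ (onReg_transition_t₂ 0 n a φ j k)
  rw [QProg.sem]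
  refine (tsum_eq_single (β := RegConfig ExB (singleReg .t₂)) (fun _ => k) ?_).trans ?_
  · intro n hn
    obtain ⟨n, rfl⟩ : ∃ m : ℤ, n = fun _ => m := ⟨n 0, funext fun i => by
      rw [Subsingleton.elim i 0]⟩
    rw [h, if_neg (fun e => hn (by rw [e])), pureState_zero]
  · rw [h, if_pos rfl]

/-- The body of the outer loop. -/
noncomputable def exOuterBody : QProg ExB 1 :=
    (QProg.apply (singleReg .t₁) shiftUnitary).seq <|
    (QProg.init .r).seq <| (QProg.init .t₂).seq <|
    exInner.seq <|
    QProg.apply (singleReg .q) hadamard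

/-- The state vector when `q` is measured after `j` rounds of the outer loop, with outcome `a`. -/
noncomputable def exRound (θ : ℝ) (a : Fin 2) (j : ℕ) : L2 (Config ExB) :=
  exVec a (rotPhi (2 ^ j * θ)) j (2 ^ j : ℕ)

/-- The body resets `r` and `t₂`, so any unit `φ` and any `k` may enter. This is what allows
iteration from the output of the previous round. -/
theorem exOuterBody_sem (θ : ℝ) {c : ℝ} (h0 : 0 ≤ c) (h1 : c ≤ 1) {φ : Fin 2 → ℂ}
    (hφ : ‖φ 0‖ ^ 2 + ‖φ 1‖ ^ 2 = 1) (j : ℕ) (k : ℤ) :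
    exOuterBody.sem (fun _ => θ) (pureState c (exVec 0 φ j k)) =
      pureState c (((√2 : ℝ) : ℂ)⁻¹ • exRound θ 0 (j + 1) +
        (-((√2 : ℝ) : ℂ)⁻¹) • exRound θ 1 (j + 1)) := by
  have h := exInner_sem θ h0 h1 (j + 1)
  rw [Nat.cast_succ] at h
  rw [exOuterBody, QProg.sem, QProg.sem_apply]
  rw [show ∀ ρ, ((QProg.init .r).seq <| (QProg.init .t₂).seq <| exInner.seq <|
    QProg.apply (singleReg .q) hadamard : QProg ExB 1).sem (fun _ => θ) ρ =
    (QProg.apply (singleReg .q) hadamard : QProg ExB 1).sem (fun _ => θ) (exInner.sem (fun _ => θ)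
      ((QProg.init .t₂).sem (fun _ => θ) ((QProg.init .r).sem (fun _ => θ) ρ))) from fun _ => rfl]
  rw [onReg_shift_t₁, init_r_sem _ _ _ hφ, init_t₂_sem, h, QProg.sem_apply, onReg_hadamard_one]
  rfl

theorem norm_exRound (θ : ℝ) (a : Fin 2) (j : ℕ) : ‖exRound θ a j‖ = 1 :=
  norm_exVec (norm_rotPhi _) _ _

/-- The fair coin: both amplitudes of `H|1⟩ = |-⟩` have squared modulus 1/2, and the sign is lost in
`|v⟩⟨v|`. -/
theorem measure_exRound (θ : ℝ) (c : ℝ) (b : Fin 2) (j : ℕ) :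
    sandwich (onReg (B := ExB) (singleReg .q) (ketBra (qket b) (qket b)))
      (pureState c (((√2 : ℝ) : ℂ)⁻¹ • exRound θ 0 j + (-((√2 : ℝ) : ℂ)⁻¹) • exRound θ 1 j)) =
    pureState (c * (1 / 2)) (exRound θ b j) := by
  have h2 : ‖((√2 : ℝ) : ℂ)⁻¹‖ ^ 2 = 1 / 2 := by simp
  rw [sandwich_pureState, map_add, map_smul, map_smul, exRound, exRound, onReg_transition_q,
    onReg_transition_q]
  fin_cases b
  · simp only [Fin.zero_eta, if_true, one_ne_zero, if_false, smul_zero, add_zero]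
    rw [pureState_smul, h2]; rfl
  · simp only [Fin.mk_one, if_true, zero_ne_one, if_false, smul_zero, zero_add]
    rw [pureState_smul, norm_neg, h2]; rfl

/-- The final state of the quantum program. -/
noncomputable def exFinal (θ : ℝ) : Op (Config ExB) :=
  ∑' n : ℕ, pureState ((1 / 2 : ℝ) ^ (n + 1)) (exRound θ 1 (n + 1))

theorem hasSum_exFinal (θ : ℝ) :
    HasSum (fun n : ℕ => pureState ((1 / 2 : ℝ) ^ (n + 1)) (exRound θ 1 (n + 1))) (exFinal θ) :=
  (summable_mixture summable_half_pow_succ (fun _ => by positivity)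
    fun _ => norm_exRound _ _ _).hasSum

theorem hasSum_half_pow_succ : HasSum (fun k : ℕ => (1 / 2 : ℝ) ^ (k + 1)) 1 := by
  simpa [pow_succ] using hasSum_geometric_two.mul_right (2⁻¹ : ℝ)

theorem exOuter_sem (θ : ℝ) :
    (whileQ exOuterBody).sem (fun _ => θ) (pureState 1 (exVec 0 (rotPhi 0) 0 0)) = exFinal θ := by
  set E : Fin 2 → Op (Config ExB) := fun b =>
    onReg (B := ExB) (singleReg .q) (ketBra (qket b) (qket b)) with hE
  set step : Op (Config ExB) → Op (Config ExB) := fun τ =>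
    exOuterBody.sem (fun _ => θ) (sandwich (E 0) τ) with hstep
  have h1 : ∀ i : ℕ, step^[i + 1] (pureState 1 (exVec 0 (rotPhi 0) 0 0)) =
      pureState ((1 / 2) ^ i) (((√2 : ℝ) : ℂ)⁻¹ • exRound θ 0 (i + 1) +
        (-((√2 : ℝ) : ℂ)⁻¹) • exRound θ 1 (i + 1)) := by
    intro i
    induction i with
    | zero =>
      have h := exOuterBody_sem θ zero_le_one le_rfl (norm_rotPhi 0) 0 0
      rw [Nat.cast_zero] at h
      rw [zero_add, Function.iterate_one, hstep]
      beta_reduce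
      rw [sandwich_pureState, hE]
      beta_reduce
      rw [onReg_transition_q, if_pos rfl, h, pow_zero]
    | succ i ih =>
      rw [Function.iterate_succ_apply', ih, hstep]
      beta_reduce
      rw [measure_exRound, exRound, exOuterBody_sem θ (by positivity) ?_ (norm_rotPhi _), pow_succ]
      rw [← pow_succ]
      exact pow_le_one₀ (by norm_num) (by norm_num)
  -- The term `k = 0` vanishes because `q` starts in `|0⟩` and leaving the loop projects onto `|1⟩`;
  -- this shifts the index by one.
  have h2 : ∀ n : ℕ, ∑ k ∈ Finset.range (n + 1),
      sandwich (E 1) (step^[k] (pureState 1 (exVec 0 (rotPhi 0) 0 0))) =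
      ∑ k ∈ Finset.range n, pureState ((1 / 2 : ℝ) ^ (k + 1)) (exRound θ 1 (k + 1)) := by
    intro n
    rw [Finset.sum_range_succ', Function.iterate_zero, id, sandwich_pureState, hE]
    beta_reduce
    rw [onReg_transition_q, if_neg (by decide), pureState_zero, add_zero]
    refine Finset.sum_congr rfl fun k _ => ?_
    rw [h1, measure_exRound, pow_succ]
  refine IsLoewnerLub.eq_loewnerLub ?_
  have h3 := isLoewnerLub_mixture hasSum_half_pow_succ le_rfl (fun _ => by positivity)
    (fun _ => norm_exRound _ _ _) (hasSum_exFinal θ)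
  simp only [← h2] at h3
  exact h3

theorem exState_eq : exState = pureState 1 (exVec 0 (rotPhi 0) 0 0) := by
  have hv : exVec 0 (rotPhi 0) 0 0 = ket 0 := by
    have h0 : exCfg 0 0 0 0 = 0 := by funext v; cases v <;> rfl
    rw [exVec, h0]
    simp [rotPhi]
  rw [exState, hv, pureState]
  simp

theorem exProg_sem (θ : ℝ) : exProg.sem (fun _ => θ) exState = exFinal θ := by
  rw [exState_eq, ← exOuter_sem]
  change (whileQ exOuterBody).sem _ ((QProg.init .t₁).sem _ ((QProg.init .q).sem _ _)) = _
  rw [init_q_sem, init_t₁_sem]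

/-! ### The expectation function -/

theorem onReg_exObs (a : Fin 2) (φ : Fin 2 → ℂ) (j k : ℤ) :
    onReg (B := ExB) (singleReg .r) (ketBra qpsi qpsi) (exVec a φ j k) =
      ((1 / 2 : ℂ) * (φ 0 + Complex.I * φ 1)) •
        (ket (exCfg a 0 j k) + (-Complex.I) • ket (exCfg a 1 j k)) := by
  have h2 := inv_sqrt_two_mul_self
  have hi : ∀ b, ketBra qpsi qpsi (qket b) =
      ((1 / 2 : ℂ) * ![1, Complex.I] b) • qket 0 +
        ((1 / 2 : ℂ) * ![1, Complex.I] b * (-Complex.I)) • qket 1 := fun b => by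
    have h : inner ℂ qpsi (qket b) = ((√2 : ℝ) : ℂ)⁻¹ * ![1, Complex.I] b := by
      rw [qpsi, inner_smul_left, inner_sub_left, inner_smul_left, inner_qket, inner_qket]
      fin_cases b <;> simp [qket_zero_one, qket_one_zero, qket_self]
    rw [ketBra_apply, h, qpsi, smul_smul, mul_right_comm, h2]
    module
  have h : ∀ b, onReg (B := ExB) (singleReg .r) (ketBra qpsi qpsi) (ket (exCfg a b j k)) =
      ((1 / 2 : ℂ) * ![1, Complex.I] b) • ket (exCfg a 0 j k) +
        ((1 / 2 : ℂ) * ![1, Complex.I] b * (-Complex.I)) • ket (exCfg a 1 j k) := fun b => by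
    refine (onReg_single_ket (B := ExB) (q := .r) (hi b)).trans ?_
    rw [update_exCfg_r, update_exCfg_r]
  rw [map_exVec, h, h]
  simp only [Matrix.cons_val_zero, Matrix.cons_val_one]
  module

/-- The value is `|φ₀ + iφ₁|²`. With `φ = (e ± 1)/2` and `e = e^{-iα}` this is `|e - i|² / 2 = 1 +
sin α`. -/
theorem inner_exObs (θ : ℝ) (j : ℕ) :
    inner ℂ (exRound θ 1 j) (exObs (exRound θ 1 j)) = ((1 + Real.sin (2 ^ j * θ) : ℝ) : ℂ) := by
  have h : ∀ α : ℝ, inner ℂ (exVec 1 (rotPhi α) j (2 ^ j : ℕ))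
      (exObs (exVec 1 (rotPhi α) j (2 ^ j : ℕ))) = ((1 + Real.sin α : ℝ) : ℂ) := fun α => by
    have hv : (ket (exCfg 1 0 j (2 ^ j : ℕ)) + (-Complex.I) • ket (exCfg 1 1 j (2 ^ j : ℕ))) =
      exVec 1 ![1, -Complex.I] j (2 ^ j : ℕ) := by simp [exVec]
    rw [exObs, smul_apply, onReg_exObs, hv, inner_smul_right, inner_smul_right,
      inner_exVec, exVec_apply, exVec_apply]
    have he : Complex.exp (-(Complex.I * α)) = Real.cos α - Real.sin α * Complex.I := by
      rw [show -(Complex.I * (α : ℂ)) = ((-α : ℝ) : ℂ) * Complex.I by push_cast; ring,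
        Complex.exp_mul_I]
      push_cast
      rw [Complex.cos_neg, Complex.sin_neg]; ring
    have hs : (Real.sin α : ℂ) ^ 2 + (Real.cos α : ℂ) ^ 2 = 1 := by
      exact_mod_cast Real.sin_sq_add_cos_sq α
    simp only [rotPhi, Matrix.cons_val_zero, Matrix.cons_val_one, he, map_div₀, map_add, map_sub,
      map_mul, Complex.conj_ofReal, Complex.conj_I, map_one, map_ofNat, Complex.ofReal_add,
      Complex.ofReal_one]
    -- What remains is a polynomial identity modulo `s² + c² = 1` and `i² = -1`.
    generalize (Real.sin α : ℂ) = s at *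
    generalize (Real.cos α : ℂ) = c at *
    have hI := Complex.I_sq
    generalize Complex.I = i at *
    linear_combination (1 / 2) * hs +
      (-(c ^ 2 - s ^ 2 * i ^ 2 - 2 * c + 1) / 4 - s - s ^ 2 / 2) * hI
  exact h _

theorem hasSum_exExpectation_aux (θ : ℝ) :
    HasSum (fun n : ℕ => (1 / 2 : ℝ) ^ (n + 1) * (1 + Real.sin (2 ^ (n + 1) * θ)))
      (1 + lacunarySine θ) := by
  simpa only [mul_add, mul_one] using hasSum_half_pow_succ.add (hasSum_lacunarySine θ)

theorem hasSum_exTrace (θ : ℝ) :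
    HasSum (fun x => (exObs * exProg.sem (fun _ => θ) exState) (ket x) x)
      ((1 + lacunarySine θ : ℝ) : ℂ) := by
  rw [exProg_sem]
  refine hasSum_trace_mixture summable_half_pow_succ (fun _ => by positivity)
    (fun _ => norm_exRound _ _ _) (hasSum_exFinal θ) exObs ?_
  simp only [inner_exObs, ← Complex.ofReal_mul]
  exact Complex.hasSum_ofReal.2 (hasSum_exExpectation_aux θ)

theorem exExpectation_eq (θ : ℝ) : exExpectation θ = 1 + lacunarySine θ := by
  rw [exExpectation, QProg.expectation, opTrace, (hasSum_exTrace θ).tsum_eq, Complex.ofReal_re]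

/-! ### Dimension of the state space, admissibility of the state and observable, and the main
theorem -/

theorem not_finiteDimensional_L2 {X : Type} [Infinite X] : ¬ FiniteDimensional ℂ (L2 X) := by
  classical
  intro h
  have hli : LinearIndependent ℂ (ket : X → L2 X) := by
    refine Orthonormal.linearIndependent (𝕜 := ℂ) (orthonormal_iff_ite.2 fun x y => ?_)
    rw [inner_ket, ket_apply]
  have := hli.finite
  exact not_finite X

theorem infinite_exProg_config : Infinite (∀ v : exProg.vars, ExB v) := by
  have ht : ExVar.t₁ ∈ exProg.vars := Or.inr (Or.inl rfl)
  refine Infinite.of_injective (fun n : ℤ => fun v : exProg.vars => exCfg 0 0 n 0 v) fun m n h => ?_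
  exact congrFun h ⟨.t₁, ht⟩

/-- As `A ⊗ I` acts slice by slice, symmetry of `A` on each slice carries over to `A ⊗ I`. -/
theorem hasSum_inner_ampliate {X Y Z : Type} (e : X ≃ Y × Z) (A : Op Y) (ψ φ : L2 X) :
    HasSum (fun z => inner ℂ (L2.slice e ψ z) (A (L2.slice e φ z)))
      (inner ℂ ψ (ampliate e A φ)) := by
  have h := (((Equiv.prodComm Z Y).trans e.symm).hasSum_iff
    (f := fun x => (starRingEnd ℂ) (ψ x) * ampliate e A φ x)).2
      (hasSum_conj_mul ψ (ampliate e A φ))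
  refine h.prod_fiberwise fun z => ?_
  convert hasSum_conj_mul (L2.slice e ψ z) (A (L2.slice e φ z)) using 2 with y
  change _ * A (L2.slice e φ (e (e.symm (y, z))).2) (e (e.symm (y, z))).1 = _
  rw [Equiv.apply_symm_apply]
  rfl

theorem isSelfAdjoint_ampliate {X Y Z : Type} (e : X ≃ Y × Z) {A : Op Y} (hA : IsSelfAdjoint A) :
    IsSelfAdjoint (ampliate e A) := by
  rw [ContinuousLinearMap.isSelfAdjoint_iff_isSymmetric] at hA ⊢
  intro ψ φ
  have h1 := hasSum_inner_ampliate e A ψ φ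
  have h2 := Complex.hasSum_conj'.2 (hasSum_inner_ampliate e A φ ψ)
  simp only [inner_conj_symm] at h2
  have h3 : (fun z => inner ℂ (A (L2.slice e ψ z)) (L2.slice e φ z)) =
      fun z => inner ℂ (L2.slice e ψ z) (A (L2.slice e φ z)) :=
    funext fun z => hA (L2.slice e ψ z) (L2.slice e φ z)
  rw [h3] at h2
  exact h2.unique h1

theorem isSelfAdjoint_exObs : IsSelfAdjoint exObs := by
  refine IsSelfAdjoint.smul (by simp [IsSelfAdjoint]) (isSelfAdjoint_ampliate _ ?_)
  exact star_ketBra _ _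

theorem isPartialDensity_exState : IsPartialDensity exState := by
  rw [exState_eq]
  exact isPartialDensity_pureState zero_le_one le_rfl (norm_exVec (norm_rotPhi _) _ _)

theorem mainTheorem9 :
    -- the program has an infinite-dimensional state space
    ¬ FiniteDimensional ℂ (L2 (∀ v : exProg.vars, ExB v)) ∧
    -- the trace that defines the expectation converges to the expectation
    (∀ θ : ℝ, HasSum (fun x => (exObs * exProg.sem (fun _ => θ) exState) (ket x) x)
      (exExpectation θ : ℂ)) ∧
    -- the expectation function, as a convergent series
    (∀ θ : ℝ, HasSum (fun k : ℕ => (1 / 2 : ℝ) ^ (k + 1) * Real.sin (2 ^ (k + 1) * θ))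
      (exExpectation θ - 1)) ∧
    (∀ θ : ℝ, exExpectation θ =
      1 + ∑' k : ℕ, (1 / 2 : ℝ) ^ (k + 1) * Real.sin (2 ^ (k + 1) * θ)) ∧
    Continuous exExpectation ∧
    (∀ θ : ℝ, ¬ DifferentiableAt ℝ exExpectation θ) ∧
    -- the probabilistic program: the expected value of `r` after the run, from every initial state
    (∀ (θ : ℝ) (s : CState),
      HasSum (fun t => ((classicalProg θ).run s t).toReal * t.r) (exExpectation θ)) ∧
    -- without finite-dimensionality, partial derivatives of expectation functions need not exist
    ¬ ∀ (V : Type) [Fintype V] (B : V → Type) [∀ v, Zero (B v)] (k : ℕ) (P : QProg B k)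
        (ρ O : Op (Config B)), IsPartialDensity ρ → IsSelfAdjoint O →
        ∀ (θ : Fin k → ℝ) (j : Fin k),
          DifferentiableAt ℝ (fun t => P.expectation ρ O (Function.update θ j t)) (θ j) := by
  have hnd : ∀ θ : ℝ, ¬ DifferentiableAt ℝ exExpectation θ := fun θ hd => by
    refine not_differentiableAt_lacunarySine θ ?_
    have : lacunarySine = fun θ => exExpectation θ - 1 := by
      funext θ; rw [exExpectation_eq]; ring
    rw [this]
    exact hd.sub_const 1
  refine ⟨?_, fun θ => ?_, fun θ => ?_, exExpectation_eq, ?_, hnd, fun θ s => ?_, fun h => ?_⟩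
  · have := infinite_exProg_config
    exact not_finiteDimensional_L2
  · rw [exExpectation_eq]
    exact hasSum_exTrace θ
  · rw [exExpectation_eq, add_sub_cancel_left]
    exact hasSum_lacunarySine θ
  · rw [funext exExpectation_eq]
    exact continuous_const.add continuous_lacunarySine
  · refine classicalProg_expectation θ s ?_
    rw [exExpectation_eq]
    simpa only [add_comm] using hasSum_exExpectation_aux θ
  · have h0 := h ExVar ExB 1 exProg exState exObs isPartialDensity_exState isSelfAdjoint_exObs
      (fun _ => 0) 0
    refine hnd 0 ?_
    convert h0 using 1
    -- With one parameter, updating the only coordinate to `t` gives the constant tuple `t`, so the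
    -- partial derivative is the derivative of `exExpectation`.
    funext t
    rw [exExpectation]
    congr 1
    funext i
    rw [Subsingleton.elim i 0, Function.update_self]
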